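/- Let $\Gamma$ be a cyclic group of order $r+1$ with $r\ge 1$, and let $\gamma_i$ ($i\in\mathbb Z/(r+1)$) be its irreducible characters, numbered so that $\gamma_i\gamma_j=\gamma_{i+j}$. Let $q$ be the coordinate character of $\mathbb C^\times$, $R(\mathbb C^\times)=\mathbb C[q,q^{-1}]$, let $p=q^s$ with $s\in\mathbb Z$, and adjoin $q^{1/2}$ so that $p^{1/2}=q^{s/2}$ makes sense. Put $$\xi=\xi^{q,p}=\gamma_0\otimes(q+q^{-1})-(\gamma_1\otimes p+\gamma_r\otimes p^{-1}).$$ On the lattice $R_{\mathbb Z}(\Gamma)=\bigoplus_i\mathbb Z\gamma_i$ let $\langle\ ,\ \rangle^1_\xi$ be the bilinear form $\langle f,g\rangle_\xi^1=|\Gamma|^{-1}\sum_{x}\xi(x)|_{q=1}f(x)g(x^{-1})$, and let $(b_{ij})$ be the skew-symmetric matrix $b_{ij}=\delta_{i+1,j}-\delta_{i-1,j}$ (indices modulo $r+1$). Let $\epsilon:R_{\mathbb Z}(\Gamma)\times R_{\mathbb Z}(\Gamma)\to\mathbb C^\times$ be a $2$-cocycle with $\epsilon(\alpha,\beta)=\epsilon(\beta,\alpha)(-1)^{\langle\alpha,\beta\rangle_\xi^1+\langle\alpha,\alpha\rangle_\xi^1\langle\beta,\beta\rangle_\xi^1}$.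 Let $\Gamma_n=\Gamma^n\rtimes S_n$, let $R(\Gamma_n\times\mathbb C^\times)$ be the space of class functions on $\Gamma_n$ with values in the coefficient ring $\mathbb C[q^{\pm1/2}]$, and let $\mathcal F=\bigl(\bigoplus_{n\ge0}R(\Gamma_n\times\mathbb C^\times)\bigr)\otimes\mathbb C[R_{\mathbb Z}(\Gamma)]$. For a representation $V$ of $\Gamma\times\mathbb C^\times$, $\eta_n(V)$ is the character of $V^{\otimes n}$ on $\Gamma_n\times\mathbb C^\times$ and $\varepsilon_n(V)$ is its product with the sign character of $S_n$; for virtual representations $\eta_n(V-W)=\sum_m(-1)^m\mathrm{Ind}\,[\eta_{n-m}(V)\otimes\varepsilon_m(W)]$, and $\varepsilon_n(V-W)$ is $\eta_n(V-W)$ times the sign character. For $n\ge0$ let $H_{-n}(X)$, $E_{-n}(X)$ be the operators $f\mapsto\mathrm{Ind}(\eta_n(X)\otimes f)$, $f\mapsto\mathrm{Ind}(\varepsilon_n(X)\otimes f)$, and let $H_n(X)$, $E_n(X)$ be restriction from $\Gamma_d$ to $\Gamma_n\times\Gamma_{d-n}$ followed by the contraction $g\mapsto|\Gamma_n|^{-1}\sum_{x\in\Gamma_n}\eta_n(\xi)(x)\,\eta_n(X)(x)\,g(x^{-1},\cdot)$,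 respectively the same with $\varepsilon_n(X)$ in place of $\eta_n(X)$ (and $0$ if $n>d$). Let $e^\alpha e^\beta=\epsilon(\alpha,\beta)e^{\alpha+\beta}$, and for $\beta=\sum_jm_j\gamma_j$ let $$z^{\partial_{\gamma_i,p}}e^\beta=z^{\langle\gamma_i,\beta\rangle_\xi^1}\,p^{-\frac12\sum_{j=0}^r\langle\gamma_i,m_j\gamma_j\rangle_\xi^1b_{ij}}\,e^\beta ,$$ let $z^{-\partial_{\gamma_i,p}}$ be its inverse, and $z^{\pm\partial_{-\gamma_i,p}}=z^{\mp\partial_{\gamma_i,p}}$. For $\gamma=\pm\gamma_i$ and $k\in\mathbb Z$ put $$Y^+(\gamma,k,z)=\Bigl(\sum_{n\ge0}H_{-n}(\gamma)z^n\Bigr)\Bigl(\sum_{n\ge0}q^{-nk}E_n(\gamma)(-z)^{-n}\Bigr)e^{\gamma}z^{\partial_{\gamma,p}},$$ $$Y^-(\gamma,k,z)=\Bigl(\sum_{n\ge0}q^{nk}E_{-n}(\gamma)(-z)^n\Bigr)\Bigl(\sum_{n\ge0}H_n(\gamma)z^{-n}\Bigr)e^{-\gamma}z^{-\partial_{\gamma,p}}.$$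 In the normal ordered product $:Y(z)Y'(w):$ of two such operators with group algebra parts $e^\alpha,e^{\alpha'}$, the two factors with operators $H_{-n},E_{-n}$ stand to the left, followed by the two factors with operators $H_n,E_n$, then $e^{\alpha+\alpha'}$, and then the two operators $z^{\pm\partial}$, $w^{\pm\partial}$. For $m\in\mathbb Z$ define rational functions, according to $\langle\gamma_i,\gamma_j\rangle^1_\xi=0,\,-1,\,2$, $$F^{(m)}_{ij}(z,w)=1,\qquad p^{\frac12b_{ij}}(z-q^mp^{b_{ij}}w)^{-1},\qquad (z-q^{m-1}w)(z-q^{m+1}w),$$ $$G^{(m)}_{ij}(z,w)=1,\qquad p^{-\frac12b_{ij}}(z-q^mp^{b_{ij}}w),\qquad (z-q^{m-1}w)^{-1}(z-q^{m+1}w)^{-1},$$ negative powers being expanded in the region $|z|>|w|$. Then for all $i,j$ with $\langle\gamma_i,\gamma_j\rangle_\xi^1\in\{0,-1,2\}$ and all $k\in\mathbb Z$ the following identities hold on $\mathcal F$, coefficient by coefficient in $z,w$ and applied to every vector (the powers of $w$ in the normal ordered product applied to a vector being bounded below, so that the products are well defined): $$Y^\pm(\gamma_i,k,z)Y^\pm(\gamma_j,k,w)=\epsilon(\pm\gamma_i,\pm\gamma_j)\,:Y^\pm(\gamma_i,k,z)Y^\pm(\gamma_j,k,w):\,F^{(\mp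 k)}_{ij},$$ $$Y^\pm(\gamma_i,k,z)Y^\mp(\gamma_j,k,w)=\epsilon(\pm\gamma_i,\mp\gamma_j)\,:Y^\pm(\gamma_i,k,z)Y^\mp(\gamma_j,k,w):\,G^{(0)}_{ij},$$ $$Y^\pm(\gamma_i,k,z)Y^\pm(-\gamma_j,-k,w)=\epsilon(\pm\gamma_i,\mp\gamma_j)\,:Y^\pm(\gamma_i,k,z)Y^\pm(-\gamma_j,-k,w):\,G^{(-k)}_{ij},$$ $$Y^+(\gamma_i,k,z)Y^-(-\gamma_j,-k,w)=\epsilon(\gamma_i,\gamma_j)\,:Y^+(\gamma_i,k,z)Y^-(-\gamma_j,-k,w):\,F^{(-2k)}_{ij},$$ $$Y^-(\gamma_i,k,z)Y^+(-\gamma_j,-k,w)=\epsilon(-\gamma_i,-\gamma_j)\,:Y^-(\gamma_i,k,z)Y^+(-\gamma_j,-k,w):\,F^{(0)}_{ij}.$$ If $\epsilon$ is bimultiplicative with values in $\{\pm1\}$, then $\epsilon(\pm\gamma_i,\pm'\gamma_j)=\epsilon(\gamma_i,\gamma_j)$ for all choices of the two signs, so all prefactors equal $\epsilon(\gamma_i,\gamma_j)$.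 -/

import Mathlib

open scoped BigOperators

noncomputable section

namespace QVertex

/-- The coefficient ring `ℂ[q^{1/2}, q^{-1/2}]`: the representation ring `R(ℂˣ) = ℂ[q, q⁻¹]` with a
square root of `q` adjoined, so that `p^{1/2}` makes sense for `p = q ^ s`.  The variable `T 1` of
the Laurent polynomials is `q^{1/2}`. -/
abbrev K : Type := LaurentPolynomial ℂ

/-- `q ^ n`. -/
def qPow (n : ℤ) : K := LaurentPolynomial.T (2 * n)

/-- `p ^ n`, where `p = q ^ s`. -/
def pPow (s n : ℤ) : K := qPow (s * n)

/-- `p ^ (n / 2)`, where `p = q ^ s`. -/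
def pHalfPow (s n : ℤ) : K := LaurentPolynomial.T (s * n)

section Wreath

/-! ### Wreath products and their class functions -/

variable (Γ : Type*) [Group Γ]

/-- The wreath product `Γ_n = Γⁿ ⋊ S_n`, where `S_n` acts on `Γⁿ` by permuting the factors. -/
abbrev Wreath (n : ℕ) : Type _ :=
  (Fin n → Γ) ⋊[(mulAutArrow : Equiv.Perm (Fin n) →* MulAut (Fin n → Γ))] Equiv.Perm (Fin n)

instance instFintypeWreath [Fintype Γ] (n : ℕ) : Fintype (Wreath Γ n) :=
  Fintype.ofEquiv _ SemidirectProduct.equivProd.symm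

variable {Γ}

theorem mulAutArrow_eq {n : ℕ} (τ : Equiv.Perm (Fin n)) (f : Fin n → Γ) :
    (mulAutArrow : Equiv.Perm (Fin n) →* MulAut (Fin n → Γ)) τ f = fun i => f (τ⁻¹ i) := rfl

/-- The identification of `{0,…,n-1} ⊔ {0,…,m-1}` with `{0,…,d-1}` when `n + m = d`. -/
def blocks {n m d : ℕ} (h : n + m = d) : Fin n ⊕ Fin m ≃ Fin d :=
  finSumFinEquiv.trans (finCongr h)

/-- The block embedding `Γ_n × Γ_m → Γ_{n+m}`. -/
def blockEmb {n m d : ℕ} (h : n + m = d) : Wreath Γ n × Wreath Γ m →* Wreath Γ d where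
  toFun x :=
    ⟨fun i => Sum.elim x.1.left x.2.left ((blocks h).symm i),
      (blocks h).permCongr (Equiv.sumCongr x.1.right x.2.right)⟩
  map_one' := by
    ext i
    · simp only [Prod.fst_one, Prod.snd_one, SemidirectProduct.one_left, Pi.one_apply]
      rcases (blocks h).symm i with a | a <;> rfl
    · simp
  map_mul' x y := by
    ext i
    · obtain ⟨j, rfl⟩ := (blocks h).surjective i
      have key : ((blocks h).permCongr (Equiv.sumCongr x.1.right x.2.right))⁻¹ (blocks h j)
          = blocks h ((Equiv.sumCongr x.1.right x.2.right).symm j) := by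
        rw [Equiv.Perm.inv_eq_iff_eq]
        simp
      simp only [Prod.fst_mul, Prod.snd_mul, SemidirectProduct.mul_left, Pi.mul_apply,
        mulAutArrow_eq, key]
      rcases j with a | a <;> simp
    · obtain ⟨j, rfl⟩ := (blocks h).surjective i
      rcases j with a | a <;> simp

variable (Γ)

/-- `R(Γ_n × ℂˣ)`: the class functions on `Γ_n` with values in the coefficient ring. -/
def ClassFn (n : ℕ) : Submodule K (Wreath Γ n → K) where
  carrier := {f | ∀ u x, f (u * x * u⁻¹) = f x}
  add_mem' hf hg u x := by simp [hf u x, hg u x]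
  zero_mem' u x := rfl
  smul_mem' c f hf u x := by simp [hf u x]

/-- `R_{Γ × ℂˣ} = ⨁ₙ R(Γ_n × ℂˣ)`. -/
abbrev RGr : Type _ := DirectSum ℕ (fun n => ClassFn Γ n)

variable {Γ}

section Ops

variable [Fintype Γ]

open Classical in
/-- The induction product `R(Γ_n × ℂˣ) ⊗ R(Γ_m × ℂˣ) → R(Γ_{n+m} × ℂˣ)`, linear in the second
argument: the function induced from the subgroup `Γ_n × Γ_m` of `Γ_{n+m}`. -/
def indProd {n m d : ℕ} (h : n + m = d) (f : ClassFn Γ n) : ClassFn Γ m →ₗ[K] ClassFn Γ d where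
  toFun g :=
    ⟨fun x => LaurentPolynomial.C ((Fintype.card (Wreath Γ n × Wreath Γ m) : ℂ)⁻¹) *
      ∑ y : Wreath Γ d, ∑ w : Wreath Γ n × Wreath Γ m,
        if y⁻¹ * x * y = blockEmb h w then f.1 w.1 * g.1 w.2 else 0, by
      intro u x
      dsimp only
      congr 1
      refine Fintype.sum_equiv (Equiv.mulLeft u⁻¹) _ _ fun y => ?_
      simp [mul_assoc]⟩
  map_add' g g' := by
    ext1
    funext x
    simp only [Submodule.coe_add, Pi.add_apply, ← mul_add, ← Finset.sum_add_distrib]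
    congr 1
    refine Finset.sum_congr rfl fun y _ => Finset.sum_congr rfl fun w _ => ?_
    split_ifs
    · ring
    · simp
  map_smul' c g := by
    ext1
    funext x
    simp only [SetLike.val_smul, Pi.smul_apply, smul_eq_mul, RingHom.id_apply]
    rw [mul_left_comm]
    congr 1
    rw [Finset.mul_sum]
    refine Finset.sum_congr rfl fun y _ => ?_
    rw [Finset.mul_sum]
    refine Finset.sum_congr rfl fun w _ => ?_
    split_ifs
    · ring
    · simp

/-- Restriction from `Γ_d` to `Γ_n × Γ_m` followed by the weighted form
`⟨f, ·⟩_ξ = |Γ_n|⁻¹ ∑ₓ η_n(ξ)(x) f(x) (·)(x⁻¹)` in the first factor; `e` stands for `η_n(ξ)`. -/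
def contract {n m d : ℕ} (h : n + m = d) (e f : ClassFn Γ n) :
    ClassFn Γ d →ₗ[K] ClassFn Γ m where
  toFun g :=
    ⟨fun y => LaurentPolynomial.C ((Fintype.card (Wreath Γ n) : ℂ)⁻¹) *
      ∑ x : Wreath Γ n, e.1 x * f.1 x * g.1 (blockEmb h (x⁻¹, y)), by
      intro u y
      dsimp only
      congr 1
      refine Finset.sum_congr rfl fun x _ => ?_
      have h1 : blockEmb h (x⁻¹, u * y * u⁻¹)
          = blockEmb h (1, u) * blockEmb h (x⁻¹, y) * (blockEmb h (1, u))⁻¹ := by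
        rw [← map_inv, ← map_mul, ← map_mul]
        simp
      rw [h1, g.2]⟩
  map_add' g g' := by
    ext1
    funext x
    simp [mul_add, Finset.sum_add_distrib]
  map_smul' c g := by
    ext1
    funext x
    simp only [SetLike.val_smul, Pi.smul_apply, smul_eq_mul, RingHom.id_apply]
    rw [mul_left_comm]
    congr 1
    rw [Finset.mul_sum]
    refine Finset.sum_congr rfl fun y _ => ?_
    ring

/-- The operator on `R_{Γ × ℂˣ}` sending `g ∈ R(Γ_m × ℂˣ)` to `Ind (f ⊗ g)`. -/
def creation {n : ℕ} (f : ClassFn Γ n) : Module.End K (RGr Γ) :=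
  DirectSum.toModule K ℕ (RGr Γ) fun m =>
    DirectSum.lof K ℕ (fun n => ClassFn Γ n) (n + m) ∘ₗ indProd rfl f

/-- The operator on `R_{Γ × ℂˣ}` sending `g ∈ R(Γ_d × ℂˣ)` to the contraction of `Res g` with
`f` (to `0` if `d < n`). -/
def annihilation {n : ℕ} (e f : ClassFn Γ n) : Module.End K (RGr Γ) :=
  DirectSum.toModule K ℕ (RGr Γ) fun d =>
    if h : n ≤ d then
      DirectSum.lof K ℕ (fun n => ClassFn Γ n) (d - n) ∘ₗ contract (Nat.add_sub_cancel' h) e f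
    else 0

end Ops

/-! ### Representations of `Γ × ℂˣ` and the characters of their tensor powers -/

variable (Γ)

/-- A representation of `Γ × ℂˣ` of the form `⨁ₐ χₐ ⊗ q ^ kₐ`, with linear characters `χₐ` of `Γ`
(every finite-dimensional rational representation has this form when `Γ` is finite abelian). -/
structure TRep where
  dim : ℕ
  chi : Fin dim → (Γ →* ℂˣ)
  wt : Fin dim → ℤ

variable {Γ}

namespace TRep

/-- The one-dimensional representation `χ ⊗ q ^ k`. -/
def single (χ : Γ →* ℂˣ) (k : ℤ) : TRep Γ := ⟨1, fun _ => χ, fun _ => k⟩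

/-- The zero representation. -/
def zero : TRep Γ := ⟨0, Fin.elim0, Fin.elim0⟩

/-- The matrix by which `(x, t)` acts; entries are Laurent polynomials in the coordinate of
`t ∈ ℂˣ`. -/
def act (V : TRep Γ) (x : Γ) : Matrix (Fin V.dim) (Fin V.dim) K :=
  Matrix.diagonal fun a => LaurentPolynomial.C ((V.chi a x : ℂˣ) : ℂ) * qPow (V.wt a)

/-- The matrix by which `((g, σ), t) ∈ Γ_n × ℂˣ` acts on `V^{⊗ n}`:
`v₁ ⊗ ⋯ ⊗ vₙ ↦ (g₁, t) v_{σ⁻¹(1)} ⊗ ⋯ ⊗ (gₙ, t) v_{σ⁻¹(n)}`. -/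
def tensorAct (V : TRep Γ) (n : ℕ) (x : Wreath Γ n) :
    Matrix (Fin n → Fin V.dim) (Fin n → Fin V.dim) K :=
  fun j' j => ∏ i, V.act (x.left i) (j' i) (j (x.right⁻¹ i))

theorem prod_act_eq (V : TRep Γ) {n : ℕ} (g : Fin n → Γ) (σ : Equiv.Perm (Fin n))
    (j : Fin n → Fin V.dim) :
    ∏ i, V.act (g i) (j i) (j (σ⁻¹ i)) = if j ∘ σ = j then
      ∏ i, LaurentPolynomial.C ((V.chi (j i) (g i) : ℂˣ) : ℂ) * qPow (V.wt (j i)) else 0 := by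
  split_ifs with hj
  · refine Finset.prod_congr rfl fun i _ => ?_
    have h1 : j (σ⁻¹ i) = j i := by
      conv_lhs => rw [← hj]
      simp
    rw [h1, act, Matrix.diagonal_apply_eq]
  · have : ∃ i, j (σ⁻¹ i) ≠ j i := by
      by_contra hcon
      push Not at hcon
      apply hj
      funext i
      have := hcon (σ i)
      simpa using this.symm
    obtain ⟨i, hi⟩ := this
    exact Finset.prod_eq_zero (Finset.mem_univ i) (Matrix.diagonal_apply_ne _ hi.symm)

/-- The character of `V^{⊗ n}` as a representation of `Γ_n × ℂˣ`. -/
def tensorChar (V : TRep Γ) (n : ℕ) : ClassFn Γ n :=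
  ⟨fun x => (V.tensorAct n x).trace, by
    intro u x
    simp only [Matrix.trace, Matrix.diag, tensorAct]
    simp only [prod_act_eq]
    refine Fintype.sum_equiv (Equiv.arrowCongr u.right⁻¹ (Equiv.refl _)) _ _ fun j => ?_
    have e1 : ((Equiv.arrowCongr u.right⁻¹ (Equiv.refl _)) j) = j ∘ u.right := by
      rfl
    rw [e1]
    have e2 : (j ∘ (u * x * u⁻¹).right = j) ↔ (j ∘ u.right) ∘ x.right = j ∘ u.right := by
      constructor
      · intro h
        funext i
        have := congrFun h (u.right i)
        simpa using this
      · intro h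
        funext i
        have := congrFun h (u.right⁻¹ i)
        simpa using this
    simp only [e2]
    split_ifs with hj
    · simp only [Finset.prod_mul_distrib]
      congr 1
      · have e4 : ∀ i, V.chi (j i) ((u * x * u⁻¹).left i)
            = V.chi (j i) (u.left i) * V.chi (j i) (x.left (u.right⁻¹ i)) *
              (V.chi (j i) (u.left (u.right (x.right⁻¹ (u.right⁻¹ i)))))⁻¹ := by
          intro i
          rw [← map_inv, ← map_mul, ← map_mul]
          congr 1
        have e5 : ∏ i, V.chi (j i) ((u * x * u⁻¹).left i)
            = ∏ i, V.chi (j (u.right i)) (x.left i) := by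
          simp only [e4, Finset.prod_mul_distrib]
          rw [← Equiv.prod_comp u.right
              (fun i => V.chi (j i) (x.left (u.right⁻¹ i))),
            ← Equiv.prod_comp (u.right * x.right)
              (fun i => (V.chi (j i) (u.left (u.right (x.right⁻¹ (u.right⁻¹ i)))))⁻¹),
            ← Equiv.prod_comp u.right (fun i => V.chi (j i) (u.left i))]
          have e3 : ∀ i, j (u.right (x.right i)) = j (u.right i) := fun i => congrFun hj i
          simp [e3, mul_comm]
        have e6 := congrArg (fun t : ℂˣ => (LaurentPolynomial.C (t : ℂ) : K)) e5
        simpa only [Units.coe_prod, map_prod, Function.comp_apply] using e6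
      · exact (Equiv.prod_comp u.right (fun i => qPow (V.wt (j i)))).symm
    · rfl⟩

end TRep

/-- Multiplication of a class function on `Γ_n` by the sign character of `S_n`. -/
def signTwist {n : ℕ} (f : ClassFn Γ n) : ClassFn Γ n :=
  ⟨fun x => ((Equiv.Perm.sign x.right : ℤ) : K) * f.1 x, by
    intro u x
    have h1 : Equiv.Perm.sign (u * x * u⁻¹).right = Equiv.Perm.sign x.right := by
      simp only [SemidirectProduct.mul_right, SemidirectProduct.inv_right, Equiv.Perm.sign_mul,
        Equiv.Perm.sign_inv]
      rw [mul_comm, ← mul_assoc, Int.units_mul_self, one_mul]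
    dsimp only
    rw [h1, f.2]⟩

variable (Γ)

/-- A virtual representation `pos - neg` of `Γ × ℂˣ`. -/
structure VRep where
  pos : TRep Γ
  neg : TRep Γ

variable {Γ}

/-- `η_n(V - W) = ∑_m (-1)^m Ind [η_{n-m}(V) ⊗ ε_m(W)]`, where `η_n(V)` is the character of
`V^{⊗ n}` and `ε_n(W)` is the character of `W^{⊗ n}` tensored with the sign character. -/
def eta [Fintype Γ] (X : VRep Γ) (n : ℕ) : ClassFn Γ n :=
  ∑ m : Fin (n + 1), (-1 : K) ^ (m : ℕ) •
    indProd (Nat.sub_add_cancel (Nat.le_of_lt_succ m.2)) (X.pos.tensorChar (n - m))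
      (signTwist (X.neg.tensorChar m))

/-- `ε_n(X)`: the product of `η_n(X)` with the sign character. -/
def eps [Fintype Γ] (X : VRep Γ) (n : ℕ) : ClassFn Γ n := signTwist (eta X n)

end Wreath

/-! ### The cyclic group and the `(q,p)`-weight -/

section Cyclic

variable {r : ℕ} {Γ : Type*} [Group Γ]
variable (γ : Multiplicative (ZMod (r + 1)) ≃* (Γ →* ℂˣ))

/-- The irreducible character `γ_i`. -/
def chr (i : ZMod (r + 1)) : Γ →* ℂˣ := γ (Multiplicative.ofAdd i)

/-- `ξ^{q,p} = γ_0 ⊗ (q + q⁻¹) - (γ_1 ⊗ p + γ_r ⊗ p⁻¹)`, where `p = q ^ s`. -/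
def xi (s : ℤ) : VRep Γ where
  pos := ⟨2, ![chr γ 0, chr γ 0], ![1, -1]⟩
  neg := ⟨2, ![chr γ 1, chr γ (r : ZMod (r + 1))], ![s, -s]⟩

/-- The lattice `R_ℤ(Γ)`: integral combinations `∑ m_j γ_j` of the irreducible characters. -/
abbrev RLat (r : ℕ) : Type := ZMod (r + 1) → ℤ

/-- The entries of the matrix of `⟨ , ⟩_ξ^1` in the basis `γ_0, …, γ_r`; see
`weightedFormOne_eq` for the comparison with the definition as an average over `Γ`. -/
def cartan (i j : ZMod (r + 1)) : ℤ :=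
  2 * (if i = j then 1 else 0) - (if i + 1 = j then 1 else 0) - (if i - 1 = j then 1 else 0)

/-- The character of a representation of `Γ × ℂˣ` specialised at `q = 1`. -/
def TRep.charOne (V : TRep Γ) (x : Γ) : ℂ := ∑ a, ((V.chi a x : ℂˣ) : ℂ)

/-- The weighted form `⟨γ_i, γ_j⟩_ξ^1 = |Γ|⁻¹ ∑ₓ ξ^1(x) γ_i(x) γ_j(x⁻¹)`. -/
def weightedFormOne [Fintype Γ] (s : ℤ) (i j : ZMod (r + 1)) : ℂ :=
  (Fintype.card Γ : ℂ)⁻¹ * ∑ x : Γ,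
    ((xi γ s).pos.charOne x - (xi γ s).neg.charOne x) *
      ((chr γ i x : ℂˣ) : ℂ) * ((chr γ j x⁻¹ : ℂˣ) : ℂ)

theorem average_chr [Fintype Γ] (i : ZMod (r + 1)) :
    (Fintype.card Γ : ℂ)⁻¹ * ∑ x : Γ, ((chr γ i x : ℂˣ) : ℂ) = if i = 0 then 1 else 0 := by
  classical
  have h := sum_hom_units ((Units.coeHom ℂ).comp (chr γ i))
  simp only [MonoidHom.comp_apply, Units.coeHom_apply] at h
  rw [h]
  have h2 : (Units.coeHom ℂ).comp (chr γ i) = 1 ↔ i = 0 := by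
    constructor
    · intro h3
      have h4 : chr γ i = 1 := by
        ext x
        simpa using DFunLike.congr_fun h3 x
      have h5 : Multiplicative.ofAdd i = 1 := γ.injective (by rw [map_one]; exact h4)
      exact h5
    · rintro rfl
      ext x
      simp [chr]
  have h6 : (Fintype.card Γ : ℂ) ≠ 0 := by
    exact_mod_cast Fintype.card_ne_zero
  simp only [h2]
  by_cases h3 : i = 0
  · simp [h3, h6]
  · simp [h3]

theorem chr_mul_chr (i j l : ZMod (r + 1)) (x : Γ) :
    ((chr γ l x : ℂˣ) : ℂ) * ((chr γ i x : ℂˣ) : ℂ) * ((chr γ j x⁻¹ : ℂˣ) : ℂ)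
      = ((chr γ (l + i - j) x : ℂˣ) : ℂ) := by
  have h : chr γ (l + i - j) = chr γ l * chr γ i * (chr γ j)⁻¹ := by
    simp only [chr, ofAdd_sub, ofAdd_add, map_mul, div_eq_mul_inv]
    rw [map_inv]
  rw [h]
  simp

/-- The integers `cartan i j` are the values `⟨γ_i, γ_j⟩_ξ^1` of the weighted form. -/
theorem weightedFormOne_eq [Fintype Γ] (s : ℤ) (i j : ZMod (r + 1)) :
    weightedFormOne γ s i j = (cartan i j : ℂ) := by
  have hr : (r : ZMod (r + 1)) = -1 := by
    have : ((r + 1 : ℕ) : ZMod (r + 1)) = 0 := ZMod.natCast_self _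
    push_cast at this
    exact eq_neg_of_add_eq_zero_left this
  have h0 := average_chr γ (0 + i - j)
  have h1 := average_chr γ (1 + i - j)
  have h2 := average_chr γ ((r : ZMod (r + 1)) + i - j)
  have key : weightedFormOne γ s i j
      = (Fintype.card Γ : ℂ)⁻¹ * (2 * ∑ x : Γ, ((chr γ (0 + i - j) x : ℂˣ) : ℂ)
        - ∑ x : Γ, ((chr γ (1 + i - j) x : ℂˣ) : ℂ)
        - ∑ x : Γ, ((chr γ ((r : ZMod (r + 1)) + i - j) x : ℂˣ) : ℂ)) := by
    unfold weightedFormOne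
    congr 1
    rw [Finset.mul_sum, ← Finset.sum_sub_distrib, ← Finset.sum_sub_distrib]
    refine Finset.sum_congr rfl fun x _ => ?_
    have c1 : (xi γ s).pos.charOne x = ((chr γ 0 x : ℂˣ) : ℂ) + ((chr γ 0 x : ℂˣ) : ℂ) :=
      Fin.sum_univ_two _
    have c2 : (xi γ s).neg.charOne x
        = ((chr γ 1 x : ℂˣ) : ℂ) + ((chr γ (r : ZMod (r + 1)) x : ℂˣ) : ℂ) :=
      Fin.sum_univ_two _
    rw [c1, c2, ← chr_mul_chr, ← chr_mul_chr, ← chr_mul_chr]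
    ring
  have e0 : (0 + i - j = 0) ↔ i = j := by rw [zero_add, sub_eq_zero]
  have e1 : (1 + i - j = 0) ↔ i + 1 = j := by rw [sub_eq_zero, add_comm 1 i]
  have e2 : ((r : ZMod (r + 1)) + i - j = 0) ↔ i - 1 = j := by
    rw [hr, sub_eq_zero, neg_add_eq_sub]
  rw [key, mul_sub, mul_sub, h1, h2, mul_left_comm, h0]
  simp only [e0, e1, e2, cartan]
  push_cast
  rfl

/-- The skew-symmetric matrix `b` with `b_{i,i+1} = 1`, `b_{i,i-1} = -1` (indices modulo `r + 1`)
and all other entries `0`. -/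
def bMat (i j : ZMod (r + 1)) : ℤ :=
  (if i + 1 = j then 1 else 0) - (if i - 1 = j then 1 else 0)

/-- The form `⟨γ_i, β⟩_ξ^1` for `β = ∑ m_j γ_j`. -/
def pair (i : ZMod (r + 1)) (β : RLat r) : ℤ := ∑ j, β j * cartan i j

/-- The form `⟨α, β⟩_ξ^1` on the lattice. -/
def latForm (α β : RLat r) : ℤ := ∑ i, α i * pair i β

/-- `∑_j ⟨γ_i, m_j γ_j⟩_ξ^1 b_{ij}` for `β = ∑ m_j γ_j`. -/
def pairB (i : ZMod (r + 1)) (β : RLat r) : ℤ := ∑ j, β j * cartan i j * bMat i j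

/-- A `2`-cocycle `ε` on the lattice with
`ε(α, β) = ε(β, α) (-1)^{⟨α, β⟩ + ⟨α, α⟩⟨β, β⟩}`. -/
structure IsTwistingCocycle (ε : RLat r → RLat r → ℂˣ) : Prop where
  cocycle : ∀ α β δ, ε α β * ε (α + β) δ = ε β δ * ε α (β + δ)
  comm : ∀ α β, ε α β = ε β α * (-1) ^ (latForm α β + latForm α α * latForm β β)

/-- The elements `γ_i` and `-γ_i` of the lattice. -/
inductive PM (r : ℕ) where
  | pos (i : ZMod (r + 1))
  | neg (i : ZMod (r + 1))

namespace PM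

def idx : PM r → ZMod (r + 1)
  | pos i => i
  | neg i => i

def sgn : PM r → ℤ
  | pos _ => 1
  | neg _ => -1

/-- The lattice element `±γ_i`. -/
def vec (g : PM r) : RLat r := g.sgn • Pi.single g.idx 1

/-- The virtual representation `±γ_i ⊗ q ^ l`. -/
def rep (g : PM r) (l : ℤ) : VRep Γ :=
  match g with
  | pos i => ⟨TRep.single (chr γ i) l, TRep.zero⟩
  | neg i => ⟨TRep.zero, TRep.single (chr γ i) l⟩

end PM

variable [Fintype Γ]

/-! The group theoretic operators, for a virtual representation `X` of `Γ × ℂˣ` and `n ≥ 0`. -/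

/-- `H_{-n}(X)`: tensor with `η_n(X)` and induce. -/
def Hneg (X : VRep Γ) (n : ℕ) : Module.End K (RGr Γ) := creation (eta X n)

/-- `E_{-n}(X)`: tensor with `ε_n(X)` and induce. -/
def Eneg (X : VRep Γ) (n : ℕ) : Module.End K (RGr Γ) := creation (eps X n)

/-- `H_n(X)`: restrict and pair with `η_n(X)` by the weighted form. -/
def Hpos (s : ℤ) (X : VRep Γ) (n : ℕ) : Module.End K (RGr Γ) :=
  annihilation (eta (xi γ s) n) (eta X n)

/-- `E_n(X)`: restrict and pair with `ε_n(X)` by the weighted form. -/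
def Epos (s : ℤ) (X : VRep Γ) (n : ℕ) : Module.End K (RGr Γ) :=
  annihilation (eta (xi γ s) n) (eps X n)

/-! ### Vertex operators on the Fock space -/

variable (r Γ) in
/-- The Fock space `R_{Γ × ℂˣ} ⊗ ℂ[R_ℤ(Γ)]`; `Finsupp.single β u` is `u ⊗ e^β`. -/
abbrev Fock : Type _ := RLat r →₀ RGr Γ

variable (r Γ) in
/-- The ingredients of a vertex operator
`(∑ₙ create n zⁿ) (∑ₙ annih n z⁻ⁿ) e^{charge} M(z)`, where `M(z) e^β = scal β z^{expo β} e^β` and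
`annih n` lowers the degree by `n`. -/
structure VertexData where
  create : ℕ → Module.End K (RGr Γ)
  annih : ℕ → Module.End K (RGr Γ)
  charge : RLat r
  expo : RLat r → ℤ
  scal : RLat r → K

/-- `Y⁺(g, k, z) = H₊(g, z) E₋(g ⊗ q^{-k}, z) e^g z^{∂_{g,p}}` for `g = ±γ_i`, where
`H₊(g, z) = ∑ₙ H_{-n}(g) zⁿ`, `E₋(g ⊗ q^{-k}, z) = ∑ₙ E_n(g ⊗ q^{-k}) (-z)^{-n}` and
`z^{∂_{±γ_i,p}} e^β = (z^{⟨γ_i, β⟩} p^{-½ ∑_j ⟨γ_i, m_j γ_j⟩ b_{ij}})^{±1} e^β`. -/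
def Yplus (s : ℤ) (g : PM r) (k : ℤ) : VertexData r Γ where
  create n := Hneg (g.rep γ 0) n
  annih n := (-1 : K) ^ n • Epos γ s (g.rep γ (-k)) n
  charge := g.vec
  expo β := g.sgn * pair g.idx β
  scal β := pHalfPow s (-(g.sgn * pairB g.idx β))

/-- `Y⁻(g, k, z) = (∑ₙ q^{nk} E_{-n}(g) (-z)ⁿ) H₋(g, z) e^{-g} z^{-∂_{g,p}}` for `g = ±γ_i`, where
`H₋(g, z) = ∑ₙ H_n(g) z^{-n}`.  Here `q^{nk} E_{-n}(g) = E_{-n}(g ⊗ q^k)` is the adjoint of the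
operator `E_n(g ⊗ q^{-k})` occurring in `Y⁺(g, k, z)`, because `q` is adjoint to `q⁻¹`. -/
def Yminus (s : ℤ) (g : PM r) (k : ℤ) : VertexData r Γ where
  create n := (-1 : K) ^ n • Eneg (g.rep γ k) n
  annih n := Hpos γ s (g.rep γ 0) n
  charge := -g.vec
  expo β := -(g.sgn * pair g.idx β)
  scal β := pHalfPow s (g.sgn * pairB g.idx β)

/-- `S_n` for `n ≥ 0`, and `0` for `n < 0`. -/
def coeffAt (S : ℕ → Module.End K (RGr Γ)) (n : ℤ) : Module.End K (RGr Γ) :=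
  if 0 ≤ n then S n.toNat else 0

/-- The coefficient of `z^a` in `(∑ₙ create n zⁿ) (∑ₘ annih m z⁻ᵐ)` (on the component of degree
`d` only `m ≤ d` contribute). -/
def halves (D : VertexData r Γ) (a : ℤ) : Module.End K (RGr Γ) :=
  DirectSum.toModule K ℕ (RGr Γ) fun d =>
    (∑ m ∈ Finset.range (d + 1), coeffAt D.create (a + m) * D.annih m) ∘ₗ
      DirectSum.lof K ℕ (fun n => ClassFn Γ n) d

/-- The coefficient of `z^a w^b` in
`(∑ create n zⁿ) (∑ create' n wⁿ) (∑ annih m z⁻ᵐ) (∑ annih' m w⁻ᵐ)`. -/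
def halves₂ (D D' : VertexData r Γ) (a b : ℤ) : Module.End K (RGr Γ) :=
  DirectSum.toModule K ℕ (RGr Γ) fun d =>
    (∑ m ∈ Finset.range (d + 1), ∑ m' ∈ Finset.range (d + 1),
      coeffAt D.create (a + m) * coeffAt D'.create (b + m') * D.annih m * D'.annih m') ∘ₗ
      DirectSum.lof K ℕ (fun n => ClassFn Γ n) d

variable (ε : RLat r → RLat r → ℂˣ)

/-- The coefficient of `z^a` in the vertex operator `Y(z)`, where `e^α e^β = ε(α, β) e^{α+β}`. -/
def vertexOp (D : VertexData r Γ) (a : ℤ) : Module.End K (Fock r Γ) :=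
  Finsupp.lsum K fun β =>
    (LaurentPolynomial.C ((ε D.charge β : ℂˣ) : ℂ) * D.scal β : K) •
      (Finsupp.lsingle (D.charge + β) ∘ₗ halves D (a - D.expo β))

/-- The coefficient of `z^a w^b` in the normal ordered product `:Y(z) Y'(w):`, in which creation
parts stand to the left of annihilation parts, followed by `e^{α+α'}` and then the operators
`M(z) M'(w)`. -/
def normalProd (D D' : VertexData r Γ) (a b : ℤ) : Module.End K (Fock r Γ) :=
  Finsupp.lsum K fun β =>
    (LaurentPolynomial.C ((ε (D.charge + D'.charge) β : ℂˣ) : ℂ) * D.scal β * D'.scal β : K) •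
      (Finsupp.lsingle (D.charge + D'.charge + β) ∘ₗ
        halves₂ D D' (a - D.expo β) (b - D'.expo β))

end Cyclic

/-! ### Rational factors -/

section Series

variable {M : Type*} [AddCommGroup M] [Module K M]

/-- Multiplication of `∑ X a b z^a w^b` by `z - c w`. -/
def mulLin (c : K) (X : ℤ → ℤ → M) : ℤ → ℤ → M :=
  fun a b => X (a - 1) b - c • X a (b - 1)

/-- Multiplication of `∑ X a b z^a w^b` by `(z - c w)⁻¹ = ∑_{n ≥ 0} cⁿ z^{-n-1} wⁿ` (expanded in
the region `|z| > |w|`), for series `X` in which the powers of `w` are bounded below. -/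
def divLin (c : K) (X : ℤ → ℤ → M) : ℤ → ℤ → M :=
  fun a b => ∑ᶠ n : ℕ, c ^ n • X (a + 1 + n) (b - n)

/-- The powers of `w` in `∑ X a b z^a w^b` are bounded below. -/
def BoundedBelow (X : ℤ → ℤ → M) : Prop := ∃ B : ℤ, ∀ a b, b < B → X a b = 0

/-- If `X` is bounded below, so is its product with `(z - c w)⁻¹`. -/
theorem BoundedBelow.divLin {X : ℤ → ℤ → M} (hX : BoundedBelow X) (c : K) :
    BoundedBelow (divLin c X) := by
  obtain ⟨B, hB⟩ := hX
  refine ⟨B, fun a b hb => ?_⟩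
  refine finsum_eq_zero_of_forall_eq_zero fun n => ?_
  rw [hB _ _ (by omega), smul_zero]

/-- `divLin` is inverse to `mulLin` on series that are bounded below. -/
theorem mulLin_divLin {X : ℤ → ℤ → M} (hX : BoundedBelow X) (c : K) :
    mulLin c (divLin c X) = X := by
  obtain ⟨B, hB⟩ := hX
  funext a b
  have hfin : ∀ a b : ℤ, (Function.support fun n : ℕ => c ^ n • X (a + 1 + n) (b - n)).Finite := by
    intro a b
    refine (Set.finite_lt_nat ((b - B).toNat + 1)).subset fun n hn => ?_
    by_contra hcon
    apply hn
    simp only [Set.mem_ofPred_eq, not_lt] at hcon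
    change c ^ n • X (a + 1 + n) (b - n) = 0
    rw [hB _ _ (by omega), smul_zero]
  have h1 : ∀ a b : ℤ, ∃ N : ℕ, ∀ N' ≥ N, divLin c X a b
      = ∑ n ∈ Finset.range N', c ^ n • X (a + 1 + n) (b - n) := by
    intro a b
    refine ⟨(b - B).toNat + 1, fun N' hN' => ?_⟩
    refine finsum_eq_sum_of_support_subset _ fun n hn => ?_
    by_contra hcon
    apply hn
    simp only [Finset.coe_range, Set.mem_Iio, not_lt] at hcon
    change c ^ n • X (a + 1 + n) (b - n) = 0
    rw [hB _ _ (by omega), smul_zero]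
  obtain ⟨N1, hN1⟩ := h1 (a - 1) b
  obtain ⟨N2, hN2⟩ := h1 a (b - 1)
  rw [mulLin, hN1 (max N1 N2 + 1) (by omega), hN2 (max N1 N2) (by omega),
    Finset.sum_range_succ', Finset.smul_sum]
  have h2 : ∀ n : ℕ, c ^ (n + 1) • X (a - 1 + 1 + ((n + 1 : ℕ) : ℤ)) (b - ((n + 1 : ℕ) : ℤ))
      = c • c ^ n • X (a + 1 + n) (b - 1 - n) := by
    intro n
    rw [smul_smul, ← pow_succ']
    congr 2
    · push_cast; ring
    · push_cast; ring
  simp only [h2]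
  simp

end Series

/-- The relation `Y(z) Y'(w) = ε(α, α') F :Y(z) Y'(w):`, where `α, α'` are the charges and `F` is
an operation on formal series in `z, w` (multiplication by a scalar factor): equality of all
coefficients, applied to every vector. -/
def OPE {r : ℕ} {Γ : Type*} [Group Γ] [Fintype Γ] (ε : RLat r → RLat r → ℂˣ)
    (D D' : VertexData r Γ)
    (F : (ℤ → ℤ → Fock r Γ) → (ℤ → ℤ → Fock r Γ)) : Prop :=
  ∀ v : Fock r Γ,
    BoundedBelow (fun a b => normalProd ε D D' a b v) ∧
    ∀ a b : ℤ, vertexOp ε D a (vertexOp ε D' b v) =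
      (LaurentPolynomial.C ((ε D.charge D'.charge : ℂˣ) : ℂ) : K) •
        F (fun a b => normalProd ε D D' a b v) a b

/-- The factor `1`, `p^{b/2} (z - q^m p^b w)⁻¹`, `(z - q^{m-1} w)(z - q^{m+1} w)` according as
`⟨γ_i, γ_j⟩_ξ^1 = 0, -1, 2`. -/
def SameCharge {r : ℕ} {Γ : Type*} [Group Γ] [Fintype Γ] (s : ℤ) (ε : RLat r → RLat r → ℂˣ)
    (D D' : VertexData r Γ) (i j : ZMod (r + 1)) (m : ℤ) : Prop :=
  (cartan i j = 0 → OPE ε D D' fun X => X) ∧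
  (cartan i j = -1 → OPE ε D D' fun X =>
    pHalfPow s (bMat i j) • divLin (qPow m * pPow s (bMat i j)) X) ∧
  (cartan i j = 2 → OPE ε D D' fun X =>
    mulLin (qPow (m - 1)) (mulLin (qPow (m + 1)) X))

/-- The factor `1`, `p^{-b/2} (z - q^m p^b w)`, `(z - q^{m-1} w)⁻¹ (z - q^{m+1} w)⁻¹` according as
`⟨γ_i, γ_j⟩_ξ^1 = 0, -1, 2`. -/
def OppositeCharge {r : ℕ} {Γ : Type*} [Group Γ] [Fintype Γ] (s : ℤ) (ε : RLat r → RLat r → ℂˣ)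
    (D D' : VertexData r Γ) (i j : ZMod (r + 1)) (m : ℤ) : Prop :=
  (cartan i j = 0 → OPE ε D D' fun X => X) ∧
  (cartan i j = -1 → OPE ε D D' fun X =>
    pHalfPow s (-bMat i j) • mulLin (qPow m * pPow s (bMat i j)) X) ∧
  (cartan i j = 2 → OPE ε D D' fun X =>
    divLin (qPow (m - 1)) (divLin (qPow (m + 1)) X))

end QVertex

end

open QVertex

/-! Each vertex operator is a product of a creation series C(z), an annihilation series A(z) and a
lattice part. In Y(z)Y'(w) only A(z) has to move past C'(w), and the first lattice part past the
charge of the second. The lattice part yields a power of z and a power of p by linearity of the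
exponents, and the cocycle identity yields the sign ε. All the content lies in A(z)C'(w) = f(w/z)
C'(w)A(z) and in the computation of f.

For the commutation, class functions on all Γ_n are treated as families of functions on Γ^α ⋊ Perm α
for arbitrary finite sets α, invariant under relabelling. The induction product becomes a sum over
decompositions of α stable under the group element (`indProd_eq_conv`), and restriction becomes
evaluation on block sums. The families η_n(X), ε_n(X) of ±γ_i ⊗ q^l and η_n(ξ) are multiplicative on
block sums. Mackey's formula then reduces to splitting a disjoint union: a decomposition of Fin n ⊔
β is a pair of decompositions, the multiplicative families factor accordingly, and averaging over
Γ_n gives `contr_conv`. The coefficient of t^n in f is therefore the average over Γ_n of the product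
of the two multiplicative families.

For f itself, η(ξ) is an induction product of four linear characters of wreath products
(`etaFam_xi`). Averages turn induction products into products of power series (`avgSeries_conv`), so
f has four factors, belonging to the characters γ_d, γ_d, γ_{d-1}, γ_{d+1} with d = i - j. By
orthogonality (`avg_lin`) a factor is 1 unless its character is trivial. A trivial character gives a
geometric series when the sign character occurs to an even power, and 1 + ct when it occurs to an
odd power. The values 0, -1, 2 of the form correspond to no, one or two trivial characters, which
gives the three rational factors. -/

noncomputable section

namespace QVertex

/-! ### Wreath products over arbitrary finite index sets -/

section Species

variable {Γ : Type*} [Group Γ] {α β : Type}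

variable (Γ) in
/-- The wreath product `Γ^α ⋊ Perm α` over an arbitrary index set. -/
abbrev WreathOn (α : Type) : Type _ :=
  (α → Γ) ⋊[(mulAutArrow : Equiv.Perm α →* MulAut (α → Γ))] Equiv.Perm α

instance instFintypeWreathOn [Fintype Γ] [Fintype α] [DecidableEq α] :
    Fintype (WreathOn Γ α) :=
  Fintype.ofEquiv _ SemidirectProduct.equivProd.symm

theorem mulAutArrow_on (τ : Equiv.Perm α) (f : α → Γ) :
    (mulAutArrow : Equiv.Perm α →* MulAut (α → Γ)) τ f = fun i => f (τ⁻¹ i) := rfl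

namespace WreathOn

/-- Relabelling of the index set. -/
def map (e : α ≃ β) (x : WreathOn Γ α) : WreathOn Γ β :=
  ⟨fun b => x.left (e.symm b), e.permCongr x.right⟩

/-- The block sum. -/
def join (x : WreathOn Γ α) (y : WreathOn Γ β) : WreathOn Γ (α ⊕ β) :=
  ⟨Sum.elim x.left y.left, Equiv.sumCongr x.right y.right⟩

/-- The subset `p` of the index set is stable under the permutation part of `x`. -/
def Stable (x : WreathOn Γ α) (p : α → Bool) : Prop := ∀ a, p (x.right a) = p a

/-- Restriction to one of the two parts of a stable decomposition. -/
def res (x : WreathOn Γ α) (p : α → Bool) (h : x.Stable p) (b : Bool) :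
    WreathOn Γ {a // p a = b} :=
  ⟨fun a => x.left a, x.right.subtypePerm (fun a => by rw [h a])⟩

theorem map_refl (x : WreathOn Γ α) : map (Equiv.refl α) x = x := rfl

theorem map_map {δ : Type} (e : α ≃ β) (e' : β ≃ δ) (x : WreathOn Γ α) :
    map e' (map e x) = map (e.trans e') x := rfl

/-- This is the link between class functions and relabelling: permuting the index set is an inner
automorphism, so class functions do not see it. -/
theorem map_perm (π : Equiv.Perm α) (x : WreathOn Γ α) :
    map π x = (⟨1, π⟩ : WreathOn Γ α) * x * (⟨1, π⟩ : WreathOn Γ α)⁻¹ := by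
  ext i
  · simp only [SemidirectProduct.mul_left, SemidirectProduct.inv_left, mulAutArrow_on, map,
      Pi.mul_apply, SemidirectProduct.mul_right, Pi.one_apply, inv_one, one_mul,
      mul_one]
    rfl
  · rfl

theorem map_inv (e : α ≃ β) (x : WreathOn Γ α) : (map e x)⁻¹ = map e x⁻¹ := by
  ext i
  · simp only [SemidirectProduct.inv_left, mulAutArrow_on, map, Pi.inv_apply]
    simp
  · rfl

theorem join_inv (x : WreathOn Γ α) (y : WreathOn Γ β) : (join x y)⁻¹ = join x⁻¹ y⁻¹ := by
  ext i
  · simp only [SemidirectProduct.inv_left, mulAutArrow_on, join, Pi.inv_apply]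
    rcases i with i | i <;> rfl
  · rcases i with i | i <;> rfl

theorem blockEmb_eq {n m d : ℕ} (h : n + m = d) (x : Wreath Γ n × Wreath Γ m) :
    blockEmb h x = map (blocks h) (join x.1 x.2) := rfl

theorem stable_map {e : α ≃ β} {x : WreathOn Γ α} {p : β → Bool} :
    (map e x).Stable p ↔ x.Stable (p ∘ e) := by
  constructor
  · intro h a
    simpa [map] using h (e a)
  · intro h b
    simpa [map] using h (e.symm b)

theorem res_map {e : α ≃ β} {x : WreathOn Γ α} {p : β → Bool} (h : (map e x).Stable p)
    (b : Bool) : res (map e x) p h b =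
      map (e.subtypeEquiv fun _ => Iff.rfl) (res x (p ∘ e) (stable_map.1 h) b) := by
  ext i
  · rfl
  · rfl

theorem stable_join {x : WreathOn Γ α} {y : WreathOn Γ β} {p : α → Bool} {p' : β → Bool} :
    (join x y).Stable (Sum.elim p p') ↔ x.Stable p ∧ y.Stable p' := by
  constructor
  · intro h
    exact ⟨fun a => h (Sum.inl a), fun a => h (Sum.inr a)⟩
  · rintro ⟨h, h'⟩ (a | a)
    · exact h a
    · exact h' a

/-- The two sides live over different but canonically bijective index sets, hence the relabelling by
`Equiv.subtypeSum`; invariant families will ignore it. -/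
theorem res_join {x : WreathOn Γ α} {y : WreathOn Γ β} {p : α → Bool} {p' : β → Bool}
    (h : (join x y).Stable (Sum.elim p p')) (b : Bool) :
    res (join x y) (Sum.elim p p') h b =
      map (Equiv.subtypeSum (p := fun c => Sum.elim p p' c = b)).symm
        (join (res x p (stable_join.1 h).1 b) (res y p' (stable_join.1 h).2 b)) := by
  ext i
  · rcases i with ⟨a | a, ha⟩ <;> rfl
  · rcases i with ⟨a | a, ha⟩ <;> rfl

end WreathOn

/-- The decomposition of a set into the two parts given by `p`. -/
def splitEquiv (p : α → Bool) : {a // p a = true} ⊕ {a // p a = false} ≃ α where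
  toFun := Sum.elim Subtype.val Subtype.val
  invFun a := if h : p a = true then Sum.inl ⟨a, h⟩ else Sum.inr ⟨a, by simpa using h⟩
  left_inv := by
    rintro (⟨a, ha⟩ | ⟨a, ha⟩) <;> simp [ha]
  right_inv a := by
    by_cases h : p a = true <;> simp [h]

namespace WreathOn

theorem map_join_res (x : WreathOn Γ α) (p : α → Bool) (h : x.Stable p) :
    map (splitEquiv p) (join (res x p h true) (res x p h false)) = x := by
  ext i
  · obtain ⟨j, rfl⟩ := (splitEquiv p).surjective i
    simp only [map, Equiv.symm_apply_apply]
    rcases j with j | j <;> rfl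
  · obtain ⟨j, rfl⟩ := (splitEquiv p).surjective i
    simp only [map, Equiv.permCongr_apply, Equiv.symm_apply_apply]
    rcases j with j | j <;> rfl

theorem stable_map_join (p : α → Bool) (x : WreathOn Γ {a // p a = true})
    (y : WreathOn Γ {a // p a = false}) : (map (splitEquiv p) (join x y)).Stable p := by
  intro i
  obtain ⟨j, rfl⟩ := (splitEquiv p).surjective i
  simp only [map, Equiv.permCongr_apply, Equiv.symm_apply_apply]
  rcases j with j | j
  · exact (x.right j).2.trans j.2.symm
  · exact (y.right j).2.trans j.2.symm

theorem splitEquiv_symm_of_true (p : α → Bool) (a : {a // p a = true}) :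
    (splitEquiv p).symm a = Sum.inl a := by
  rw [Equiv.symm_apply_eq]; rfl

theorem splitEquiv_symm_of_false (p : α → Bool) (a : {a // p a = false}) :
    (splitEquiv p).symm a = Sum.inr a := by
  rw [Equiv.symm_apply_eq]; rfl

theorem res_map_join_true (p : α → Bool) (x : WreathOn Γ {a // p a = true})
    (y : WreathOn Γ {a // p a = false}) :
    res (map (splitEquiv p) (join x y)) p (stable_map_join p x y) true = x := by
  ext i
  · simp [res, map, splitEquiv_symm_of_true, join]
  · simp only [res, map, Equiv.Perm.subtypePerm_apply, Equiv.permCongr_apply,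
      splitEquiv_symm_of_true, join]
    rfl

theorem res_map_join_false (p : α → Bool) (x : WreathOn Γ {a // p a = true})
    (y : WreathOn Γ {a // p a = false}) :
    res (map (splitEquiv p) (join x y)) p (stable_map_join p x y) false = y := by
  ext i
  · simp [res, map, splitEquiv_symm_of_false, join]
  · simp only [res, map, Equiv.Perm.subtypePerm_apply, Equiv.permCongr_apply,
      splitEquiv_symm_of_false, join]
    rfl

/-- Elements that stabilise `p` are pairs of elements over the two parts. -/
def stableEquiv (p : α → Bool) :
    {x : WreathOn Γ α // x.Stable p} ≃
      WreathOn Γ {a // p a = true} × WreathOn Γ {a // p a = false} where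
  toFun x := (res x.1 p x.2 true, res x.1 p x.2 false)
  invFun y := ⟨map (splitEquiv p) (join y.1 y.2), stable_map_join p y.1 y.2⟩
  left_inv x := Subtype.ext (map_join_res x.1 p x.2)
  right_inv y := Prod.ext (res_map_join_true p y.1 y.2) (res_map_join_false p y.1 y.2)

-- The stabiliser of a decomposition is the product of the wreath groups over its two parts, so a
-- sum over stable elements is a double sum.
open Classical in
theorem sum_stable [Fintype Γ] [Fintype α] (p : α → Bool)
    (T : WreathOn Γ {a // p a = true} → WreathOn Γ {a // p a = false} → K) :
    (∑ x : WreathOn Γ α, if h : x.Stable p then T (res x p h true) (res x p h false) else 0)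
      = ∑ x, ∑ y, T x y := by
  rw [← Fintype.sum_prod_type', ← Equiv.sum_comp (stableEquiv p)]
  rw [Finset.sum_dite]
  simp only [Finset.sum_const_zero, add_zero]
  refine Finset.sum_nbij' (fun x => ⟨x.1, (Finset.mem_filter.1 x.2).2⟩)
    (fun x => ⟨x.1, by simp [x.2]⟩) ?_ ?_ ?_ ?_ ?_ <;> simp [stableEquiv]

theorem card_eq [Fintype Γ] [Fintype α] [DecidableEq α] :
    Fintype.card (WreathOn Γ α) = Fintype.card Γ ^ Fintype.card α * (Fintype.card α).factorial := by
  rw [Fintype.card_congr SemidirectProduct.equivProd]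
  simp [Fintype.card_perm]

end WreathOn

end Species

/-! ### Families of functions, induction product and multiplicativity -/

section Convolution

variable {Γ : Type*} [Group Γ] {α β : Type}

open WreathOn
open Finset.HasAntidiagonal (antidiagonal)

variable (Γ) in
/-- Families of functions on the groups `Γ^α ⋊ Perm α`. -/
abbrev Fam : Type _ := ∀ (α : Type) [Fintype α], WreathOn Γ α → K

/-- Invariance under relabelling. -/
def Invariant (F : Fam Γ) : Prop :=
  ∀ ⦃α β : Type⦄ [Fintype α] [Fintype β] (e : α ≃ β) (x : WreathOn Γ α), F β (map e x) = F α x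

/-- Multiplicativity with respect to block sums. -/
def GroupLike (F : Fam Γ) : Prop :=
  ∀ ⦃α β : Type⦄ [Fintype α] [Fintype β] (x : WreathOn Γ α) (y : WreathOn Γ β),
    F (α ⊕ β) (join x y) = F α x * F β y

/-- The pointwise product. -/
def pmul (F G : Fam Γ) : Fam Γ := fun α _ x => F α x * G α x

/-- The part of degree `n`. -/
def trunc (n : ℕ) (F : Fam Γ) : Fam Γ := fun α _ x => if Fintype.card α = n then F α x else 0

open Classical in
/-- The induction product of families. -/
def conv (F G : Fam Γ) : Fam Γ := fun α _ x =>
  ∑ p : α → Bool, if h : x.Stable p then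
    F {a // p a = true} (res x p h true) * G {a // p a = false} (res x p h false) else 0

open Classical in
/-- The average of a function over `Γ^α ⋊ Perm α`. -/
def avg [Fintype Γ] [Fintype α] (T : WreathOn Γ α → K) : K :=
  LaurentPolynomial.C ((Fintype.card (WreathOn Γ α) : ℂ)⁻¹) * ∑ x, T x

theorem conv_eq [Fintype α] [Fintype (α → Bool)] (F G : Fam Γ) (x : WreathOn Γ α)
    [∀ p, Decidable (x.Stable p)] :
    conv F G α x = ∑ p : α → Bool, if h : x.Stable p then
      F {a // p a = true} (res x p h true) * G {a // p a = false} (res x p h false) else 0 := by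
  unfold conv
  congr!

theorem Invariant.pmul {F G : Fam Γ} (hF : Invariant F) (hG : Invariant G) :
    Invariant (pmul F G) := by
  intro α β _ _ e x
  change F β _ * G β _ = F α x * G α x
  rw [hF e, hG e]

theorem GroupLike.pmul {F G : Fam Γ} (hF : GroupLike F) (hG : GroupLike G) :
    GroupLike (pmul F G) := by
  intro α β _ _ x y
  change F _ _ * G _ _ = F α x * G α x * (F β y * G β y)
  rw [hF, hG, mul_mul_mul_comm]

theorem Invariant.trunc {F : Fam Γ} (hF : Invariant F) (n : ℕ) :
    Invariant (trunc n F) := by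
  intro α β _ _ e x
  change (if _ then F β _ else 0) = if _ then F α x else 0
  rw [hF e, Fintype.card_congr e]

theorem Invariant.conv {F G : Fam Γ} (hF : Invariant F) (hG : Invariant G) :
    Invariant (conv F G) := by
  intro α β _ _ e x
  classical
  unfold QVertex.conv
  refine Fintype.sum_equiv (Equiv.arrowCongr e (Equiv.refl Bool)).symm _ _ fun p => ?_
  have hp : (Equiv.arrowCongr e (Equiv.refl Bool)).symm p = p ∘ e := rfl
  rw [hp]
  by_cases h : (map e x).Stable p
  · rw [dif_pos h, dif_pos (stable_map.1 h), res_map h, res_map h, hF, hG]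
    rfl
  · rw [dif_neg h, dif_neg (fun h' => h (stable_map.2 h'))]

/-- An element stabilising `p` is a relabelled block sum of its two restrictions; invariance removes
the relabelling. -/
theorem GroupLike.eq_res {F : Fam Γ} (hF : GroupLike F) (hF' : Invariant F) [Fintype α]
    (x : WreathOn Γ α) (p : α → Bool) (h : x.Stable p) :
    F α x = F {a // p a = true} (res x p h true) * F {a // p a = false} (res x p h false) := by
  rw [← hF, ← hF' (splitEquiv p), map_join_res]

/-- A projection formula: a multiplicative `H` restricts to an outer product on every stabiliser, so
it can be absorbed into both factors. -/
theorem pmul_conv {F G H : Fam Γ} (hH : GroupLike H) (hH' : Invariant H) :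
    pmul H (conv F G) = conv (pmul H F) (pmul H G) := by
  funext α _ x
  unfold pmul conv
  rw [Finset.mul_sum]
  refine Finset.sum_congr rfl fun p _ => ?_
  split_ifs with h
  · rw [hH.eq_res hH' x p h, mul_mul_mul_comm]
  · simp

open Classical in
/-- Restriction of the two factors of an induction product to a block sum. -/
theorem conv_join [Fintype α] [Fintype β] {F G : Fam Γ}
    (hF : Invariant F) (hG : Invariant G)
    (x : WreathOn Γ α) (y : WreathOn Γ β) :
    conv F G (α ⊕ β) (join x y) =
      ∑ p : α → Bool, ∑ p' : β → Bool, if h : x.Stable p then if h' : y.Stable p' then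
        F _ (join (res x p h true) (res y p' h' true)) *
          G _ (join (res x p h false) (res y p' h' false)) else 0 else 0 := by
  classical
  rw [conv_eq]
  refine Eq.trans ?_ (Fintype.sum_prod_type' (fun (p : α → Bool) (p' : β → Bool) =>
    if h : x.Stable p then if h' : y.Stable p' then
        F _ (join (res x p h true) (res y p' h' true)) *
          G _ (join (res x p h false) (res y p' h' false)) else 0 else 0))
  refine Fintype.sum_equiv (M := K) (Equiv.sumArrowEquivProdArrow α β Bool) _ _ fun p => ?_
  obtain ⟨⟨p, p'⟩, rfl⟩ := (Equiv.sumArrowEquivProdArrow α β Bool).symm.surjective p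
  rw [Equiv.apply_symm_apply]
  have hp : (Equiv.sumArrowEquivProdArrow α β Bool).symm (p, p') = Sum.elim p p' := rfl
  rw [hp]
  by_cases h : (join x y).Stable (Sum.elim p p')
  · have h2 := stable_join.1 h
    rw [dif_pos h, dif_pos h2.1, dif_pos h2.2, res_join h, res_join h, hF, hG]
    rfl
  · rw [dif_neg h]
    by_cases h1 : x.Stable p
    · rw [dif_pos h1, dif_neg fun h2 => h (stable_join.2 ⟨h1, h2⟩)]
    · rw [dif_neg h1]

/-- Decompositions of a disjoint union are pairs of decompositions, so the defining sum for a block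
sum factors into two sums. -/
theorem GroupLike.conv {F G : Fam Γ} (hF : GroupLike F) (hG : GroupLike G) (hF' : Invariant F)
    (hG' : Invariant G) : GroupLike (conv F G) := by
  intro α β _ _ x y
  classical
  rw [conv_join hF' hG']
  unfold QVertex.conv
  rw [Finset.sum_mul_sum]
  refine Finset.sum_congr rfl fun p _ => Finset.sum_congr rfl fun p' _ => ?_
  by_cases h1 : x.Stable p
  · by_cases h2 : y.Stable p'
    · rw [dif_pos h1, dif_pos h2, dif_pos h1, dif_pos h2, hF, hG, mul_mul_mul_comm]
    · simp [h1, h2]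
  · simp [h1]

theorem join_map_left {δ : Type} (e : α ≃ β) (x : WreathOn Γ α) (y : WreathOn Γ δ) :
    join (map e x) y = map (Equiv.sumCongr e (Equiv.refl δ)) (join x y) := by
  ext i
  · rcases i with i | i <;> rfl
  · rcases i with i | i <;> rfl

theorem join_map_right {δ : Type} (e : α ≃ β) (x : WreathOn Γ δ) (y : WreathOn Γ α) :
    join x (map e y) = map (Equiv.sumCongr (Equiv.refl δ) e) (join x y) := by
  ext i
  · rcases i with i | i <;> rfl
  · rcases i with i | i <;> rfl

/-- Truncation destroys multiplicativity, but only mildly: at most the term indexed by the two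
cardinalities survives in the sum. -/
theorem trunc_join {F : Fam Γ} (hF : GroupLike F) [Fintype α] [Fintype β] (m : ℕ)
    (x : WreathOn Γ α) (y : WreathOn Γ β) :
    trunc m F (α ⊕ β) (join x y) =
      ∑ a ∈ antidiagonal m, trunc a.1 F α x * trunc a.2 F β y := by
  unfold trunc
  rw [Fintype.card_sum, hF]
  by_cases h : Fintype.card α + Fintype.card β = m
  · rw [if_pos h, Finset.sum_eq_single (Fintype.card α, Fintype.card β)]
    · simp
    · rintro ⟨a, b⟩ _ hab
      by_cases h1 : Fintype.card α = a
      · have : Fintype.card β ≠ b := fun h2 => hab (by rw [h1, h2])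
        simp [this]
      · simp [h1]
    · simp [h]
  · rw [if_neg h]
    refine (Finset.sum_eq_zero fun a ha => ?_).symm
    rw [Finset.HasAntidiagonal.mem_antidiagonal] at ha
    by_cases h1 : Fintype.card α = a.1
    · have : Fintype.card β ≠ a.2 := fun h2 => h (by rw [h1, h2, ha])
      simp [this]
    · simp [h1]

/-- Decompositions are grouped by the size of the part marked `true`. -/
theorem sum_bool_card {M : Type*} [AddCommMonoid M] (n : ℕ) [Fintype (Fin n → Bool)]
    (f : ℕ → ℕ → M) :
    ∑ p : Fin n → Bool, f (Fintype.card {a // p a = true}) (Fintype.card {a // p a = false})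
      = ∑ a ∈ antidiagonal n, n.choose a.1 • f a.1 a.2 := by
  rw [Finset.Nat.sum_antidiagonal_eq_sum_range_succ (fun a b => n.choose a • f a b)]
  have h := Finset.sum_powerset_apply_card (fun a => f a (n - a))
    (x := (Finset.univ : Finset (Fin n)))
  rw [Finset.card_univ, Fintype.card_fin, Finset.powerset_univ] at h
  rw [← h]
  refine Finset.sum_bij' (fun p _ => Finset.univ.filter fun a => p a = true)
    (fun s _ a => decide (a ∈ s)) ?_ ?_ ?_ ?_ ?_
  · simp
  · simp
  · intro p _; funext a; simp
  · intro s _; ext a; simp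
  · intro p _
    have h1 : Fintype.card {a // p a = false} = n - Fintype.card {a // p a = true} := by
      have h2 := Fintype.card_subtype_compl (fun a => p a = true)
      rw [Fintype.card_fin] at h2
      rw [← h2]
      exact Fintype.card_congr (Equiv.subtypeEquivRight fun a => by simp)
    rw [h1, Fintype.card_subtype]

/-! ### Averages over wreath products and the Mackey-type contraction formula -/

section Average

variable [Fintype Γ]

theorem avg_eq [Fintype α] [Fintype (WreathOn Γ α)] (T : WreathOn Γ α → K) :
    avg T = LaurentPolynomial.C ((Fintype.card (WreathOn Γ α) : ℂ)⁻¹) * ∑ x, T x := by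
  unfold avg
  congr!

theorem avg_smul [Fintype α] (c : K) (T : WreathOn Γ α → K) :
    avg (fun x => c * T x) = c * avg T := by
  classical
  rw [avg_eq, avg_eq, ← Finset.mul_sum, mul_left_comm]

theorem avg_sum [Fintype α] {ι : Type*} (s : Finset ι) (T : ι → WreathOn Γ α → K) :
    avg (fun x => ∑ i ∈ s, T i x) = ∑ i ∈ s, avg (T i) := by
  classical
  simp only [avg_eq]
  rw [Finset.sum_comm, Finset.mul_sum]

theorem avg_inv [Fintype α] (T : WreathOn Γ α → K) : avg (fun x => T x⁻¹) = avg T := by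
  classical
  rw [avg_eq, avg_eq]
  congr 1
  exact Equiv.sum_comp (Equiv.inv _) T

/-- Relabelling as an equivalence. -/
def WreathOn.mapEquiv (e : α ≃ β) : WreathOn Γ α ≃ WreathOn Γ β where
  toFun := map e
  invFun := map e.symm
  left_inv x := by
    rw [map_map, e.self_trans_symm, map_refl]
  right_inv x := by
    rw [map_map, e.symm_trans_self, map_refl]

theorem avg_map [Fintype α] [Fintype β] {F : Fam Γ} (hF : Invariant F) (e : α ≃ β) :
    avg (F α) = avg (F β) := by
  classical
  rw [avg_eq, avg_eq, Fintype.card_congr (mapEquiv (Γ := Γ) e)]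
  congr 1
  exact Fintype.sum_equiv (mapEquiv e) _ _ fun x => (hF e x).symm

theorem sum_eq_card_mul_avg [Fintype α] [Fintype (WreathOn Γ α)] (T : WreathOn Γ α → K) :
    ∑ x, T x = LaurentPolynomial.C (Fintype.card (WreathOn Γ α) : ℂ) * avg T := by
  rw [avg_eq, ← mul_assoc, ← map_mul, mul_inv_cancel₀, map_one, one_mul]
  exact_mod_cast Fintype.card_ne_zero

/-- The number of decompositions with parts of sizes a and b is the binomial coefficient, which is
also the index |Γ_n| / (|Γ_a||Γ_b|). The normalising constants therefore cancel exactly. -/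
theorem avg_conv {F G : Fam Γ} (hF : Invariant F) (hG : Invariant G) (n : ℕ) :
    avg (conv F G (Fin n)) =
      ∑ a ∈ antidiagonal n, avg (F (Fin a.1)) * avg (G (Fin a.2)) := by
  classical
  let w (a b : ℕ) : K := LaurentPolynomial.C
    ((Fintype.card (WreathOn Γ (Fin a)) : ℂ) * Fintype.card (WreathOn Γ (Fin b))) *
      (avg (F (Fin a)) * avg (G (Fin b)))
  have h1 : ∑ x, conv F G (Fin n) x = ∑ p : Fin n → Bool,
      w (Fintype.card {a // p a = true}) (Fintype.card {a // p a = false}) := by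
    simp only [conv_eq, w]
    rw [Finset.sum_comm]
    refine Finset.sum_congr rfl fun p _ => ?_
    have h2 := sum_stable p (fun x y => F {a // p a = true} x * G {a // p a = false} y)
    rw [← avg_map hF (Fintype.equivFin {a // p a = true}),
      ← avg_map hG (Fintype.equivFin {a // p a = false}),
      ← Fintype.card_congr (mapEquiv (Γ := Γ) (Fintype.equivFin {a // p a = true})),
      ← Fintype.card_congr (mapEquiv (Γ := Γ) (Fintype.equivFin {a // p a = false})),
      map_mul, mul_mul_mul_comm, ← sum_eq_card_mul_avg, ← sum_eq_card_mul_avg, Finset.sum_mul_sum]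
    convert h2
  rw [avg_eq, h1, sum_bool_card n w, Finset.mul_sum]
  refine Finset.sum_congr rfl fun a ha => ?_
  rw [Finset.HasAntidiagonal.mem_antidiagonal] at ha
  simp only [w]
  rw [nsmul_eq_mul, ← mul_assoc, ← mul_assoc]
  have h3 : (LaurentPolynomial.C ((Fintype.card (WreathOn Γ (Fin n)) : ℂ)⁻¹) *
      ((n.choose a.1 : ℕ) : K) * LaurentPolynomial.C
        ((Fintype.card (WreathOn Γ (Fin a.1)) : ℂ) * Fintype.card (WreathOn Γ (Fin a.2)))) = 1 := by
    rw [← map_natCast (LaurentPolynomial.C (R := ℂ)), ← map_mul, ← map_mul]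
    have h4 : (n.choose a.1 : ℂ) * ((Fintype.card (WreathOn Γ (Fin a.1)) : ℂ) *
        Fintype.card (WreathOn Γ (Fin a.2))) = Fintype.card (WreathOn Γ (Fin n)) := by
      have h5 := Nat.add_choose_mul_factorial_mul_factorial a.2 a.1
      rw [add_comm, ha] at h5
      simp only [card_eq, Fintype.card_fin]
      rw [← h5, ← ha, pow_add]
      push_cast
      ring
    rw [mul_assoc, h4, inv_mul_cancel₀, map_one]
    exact_mod_cast Fintype.card_ne_zero
  rw [h3, one_mul]

/-- Contraction of the first block of a restricted family with `φ`. -/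
def contr (φ : Fam Γ) (n : ℕ) (G : Fam Γ) : Fam Γ := fun β _ y =>
  avg fun x : WreathOn Γ (Fin n) => φ (Fin n) x * G (Fin n ⊕ β) (join x y)

theorem Invariant.contr {G : Fam Γ} (hG : Invariant G) (φ : Fam Γ) (n : ℕ) :
    Invariant (contr φ n G) := by
  intro α β _ _ e y
  unfold QVertex.contr
  congr 1
  funext x
  rw [← hG (Equiv.sumCongr (Equiv.refl (Fin n)) e), join_map_right]

theorem avg_trunc (F : Fam Γ) (n k : ℕ) :
    avg (trunc k F (Fin n)) = if n = k then avg (F (Fin n)) else 0 := by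
  classical
  unfold trunc
  rw [Fintype.card_fin]
  split_ifs
  · rfl
  · simp [avg]

/-- Contraction with a multiplicative family of the induction product by a multiplicative
family. -/
theorem contr_conv {φ ψ G : Fam Γ} (hφ : GroupLike φ) (hφ' : Invariant φ) (hψ : GroupLike ψ)
    (hψ' : Invariant ψ) (hG : Invariant G) (n m : ℕ) [Fintype β] (y : WreathOn Γ β) :
    contr φ n (conv (trunc m ψ) G) β y =
      ∑ a ∈ antidiagonal m, if a.1 ≤ n then
        avg (pmul φ ψ (Fin a.1)) * conv (trunc a.2 ψ) (contr φ (n - a.1) G) β y else 0 := by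
  classical
  -- `G` with its second block frozen to the part of `y` outside `p`; averaging `G'` against `φ` is
  -- the contraction of `G` on that part.
  let G' (p : β → Bool) (h : y.Stable p) : Fam Γ := fun α _ x => G _ (join x (res y p h false))
  have hG' (p : β → Bool) (h : y.Stable p) : Invariant (G' p h) := by
    intro α δ _ _ e x
    simp only [G']
    rw [join_map_left, hG]
  -- For a decomposition `p'` of `Fin n` and `p` of `β`, multiplicativity of `φ` splits it along
  -- `p'`. `trunc_join` distributes the degree `m` of `ψ` between the two sides, and for fixed `p`
  -- the sum over `p'` is again an induction product.
  have h1 (x : WreathOn Γ (Fin n)) :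
      φ (Fin n) x * conv (trunc m ψ) G (Fin n ⊕ β) (join x y) =
        ∑ a ∈ antidiagonal m, ∑ p : β → Bool, if h : y.Stable p then
          trunc a.2 ψ _ (res y p h true) *
            conv (pmul φ (trunc a.1 ψ)) (pmul φ (G' p h)) (Fin n) x else 0 := by
    rw [conv_join (hψ'.trunc m) hG, Finset.sum_comm, Finset.mul_sum,
      Finset.sum_comm (s := antidiagonal m)]
    refine Finset.sum_congr rfl fun p _ => ?_
    by_cases h : y.Stable p
    · simp only [h, dif_pos]
      unfold conv
      rw [Finset.mul_sum]
      simp only [Finset.mul_sum]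
      rw [Finset.sum_comm]
      refine Finset.sum_congr rfl fun p' _ => ?_
      by_cases h' : x.Stable p'
      · simp only [h', dif_pos]
        rw [hφ.eq_res hφ' x p' h', trunc_join hψ, Finset.sum_mul, Finset.mul_sum]
        refine Finset.sum_congr rfl fun a _ => ?_
        simp only [pmul, G']
        ring
      · simp [h']
    · simp [h]
  have h0 : contr φ n (conv (trunc m ψ) G) β y =
      avg fun x => φ (Fin n) x * conv (trunc m ψ) G (Fin n ⊕ β) (join x y) := rfl
  simp only [h0, h1]
  rw [avg_sum]
  refine Finset.sum_congr rfl fun a _ => ?_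
  rw [avg_sum]
  have h2 : conv (trunc a.2 ψ) (contr φ (n - a.1) G) β y = ∑ p : β → Bool, if h : y.Stable p then
      trunc a.2 ψ _ (res y p h true) * avg (pmul φ (G' p h) (Fin (n - a.1))) else 0 := rfl
  -- The average of an induction product is a sum over sizes, and the truncation forces the first
  -- size to be `a.1`. This needs `a.1 ≤ n`, hence the condition in the final formula.
  have h3 (p : β → Bool) (h : y.Stable p) :
      avg (conv (pmul φ (trunc a.1 ψ)) (pmul φ (G' p h)) (Fin n)) = if a.1 ≤ n then
        avg (pmul φ ψ (Fin a.1)) * avg (pmul φ (G' p h) (Fin (n - a.1))) else 0 := by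
    have h4 : pmul φ (trunc a.1 ψ) = trunc a.1 (pmul φ ψ) := by
      funext α _ x
      simp only [pmul, trunc, mul_ite, mul_zero]
    rw [h4, avg_conv ((hφ'.pmul hψ').trunc _) (hφ'.pmul (hG' p h))]
    simp only [avg_trunc, ite_mul, zero_mul]
    split_ifs with h5
    · rw [Finset.sum_eq_single (a.1, n - a.1)]
      · simp
      · rintro ⟨b, c⟩ hb hbc
        rw [Finset.HasAntidiagonal.mem_antidiagonal] at hb
        refine if_neg fun h6 => hbc ?_
        simp only at hb h6
        rw [Prod.mk.injEq]
        omega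
      · intro h6
        simp [Finset.HasAntidiagonal.mem_antidiagonal, h5] at h6
    · refine Finset.sum_eq_zero fun b hb => if_neg fun h6 => h5 ?_
      rw [Finset.HasAntidiagonal.mem_antidiagonal] at hb
      omega
  split_ifs with h5
  · rw [h2, Finset.mul_sum]
    refine Finset.sum_congr rfl fun p _ => ?_
    by_cases h : y.Stable p
    · simp only [h, dif_pos]
      rw [avg_smul, h3 p h, if_pos h5, mul_left_comm]
    · simp [h, avg]
  · refine Finset.sum_eq_zero fun p _ => ?_
    by_cases h : y.Stable p
    · simp only [h, dif_pos]
      rw [avg_smul, h3 p h, if_neg h5, mul_zero]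
    · simp [h, avg]

end Average

end Convolution

/-! ### From graded class functions to families -/

section Evaluation

variable {Γ : Type*} [Group Γ] {α β : Type}

open WreathOn
open Finset.HasAntidiagonal (antidiagonal)

/-- The family of functions given by the graded components of an element. -/
def fam (u : RGr Γ) : Fam Γ := fun α _ x => (u (Fintype.card α)).1 (map (Fintype.equivFin α) x)

theorem classFn_map {n : ℕ} (f : ClassFn Γ n) (π : Equiv.Perm (Fin n)) (x : Wreath Γ n) :
    f.1 (map π x) = f.1 x := by
  rw [map_perm, f.2]

/-- Two enumerations of `α` differ by a permutation, that is by a conjugation, so the arbitrary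
choice of `Fintype.equivFin` is harmless. -/
theorem fam_apply [Fintype α] {n : ℕ} (u : RGr Γ) (e : α ≃ Fin n) (x : WreathOn Γ α) :
    fam u α x = (u n).1 (map e x) := by
  obtain rfl : Fintype.card α = n := by simpa using Fintype.card_congr e
  rw [fam, ← classFn_map _ ((Fintype.equivFin α).symm.trans e), map_map,
    ← Equiv.trans_assoc, Equiv.self_trans_symm, Equiv.refl_trans]

theorem fam_fin {n : ℕ} (u : RGr Γ) (x : Wreath Γ n) : fam u (Fin n) x = (u n).1 x :=
  fam_apply u (Equiv.refl _) x

theorem fam_invariant (u : RGr Γ) : Invariant (fam u) := by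
  intro α β _ _ e x
  rw [fam_apply u (Fintype.equivFin β), fam_apply u (e.trans (Fintype.equivFin β)), map_map]

theorem fam_ext {u v : RGr Γ} (h : ∀ n (x : Wreath Γ n), fam u (Fin n) x = fam v (Fin n) x) :
    u = v := by
  refine DFinsupp.ext fun n => Subtype.ext (funext fun x => ?_)
  rw [← fam_fin, h, fam_fin]

theorem fam_zero [Fintype α] (x : WreathOn Γ α) : fam (0 : RGr Γ) α x = 0 := rfl

theorem fam_add [Fintype α] (u v : RGr Γ) (x : WreathOn Γ α) :
    fam (u + v) α x = fam u α x + fam v α x := rfl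

theorem fam_smul [Fintype α] (c : K) (u : RGr Γ) (x : WreathOn Γ α) :
    fam (c • u) α x = c * fam u α x := rfl

theorem fam_sum [Fintype α] {ι : Type*} (s : Finset ι) (u : ι → RGr Γ) (x : WreathOn Γ α) :
    fam (∑ i ∈ s, u i) α x = ∑ i ∈ s, fam (u i) α x := by
  classical
  induction s using Finset.induction_on with
  | empty => rfl
  | insert a s ha ih => rw [Finset.sum_insert ha, Finset.sum_insert ha, fam_add, ih]

/-- A class function as a homogeneous element. -/
abbrev homog {n : ℕ} (f : ClassFn Γ n) : RGr Γ := DirectSum.lof K ℕ (fun n => ClassFn Γ n) n f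

theorem fam_homog [Fintype α] {n : ℕ} (f : ClassFn Γ n) (e : α ≃ Fin n) (x : WreathOn Γ α) :
    fam (homog f) α x = f.1 (map e x) := by
  rw [fam_apply _ e]
  erw [DirectSum.lof_apply]

theorem fam_homog_of_ne [Fintype α] {n : ℕ} (f : ClassFn Γ n) (h : Fintype.card α ≠ n)
    (x : WreathOn Γ α) : fam (homog f) α x = 0 := by
  have h1 : homog f (Fintype.card α) = 0 := DirectSum.of_eq_of_ne _ _ _ h
  rw [fam, h1]
  rfl

/-- An invariant family is determined in degree `n` by its values on `Fin n`; this lets the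
operators be described by families defined in all degrees at once. -/
theorem fam_homog_eq_trunc {n : ℕ} (f : ClassFn Γ n) {F : Fam Γ} (hF : Invariant F)
    (h : ∀ x, f.1 x = F (Fin n) x) : fam (homog f) = trunc n F := by
  funext α _ x
  by_cases hn : Fintype.card α = n
  · rw [fam_homog f (Fintype.equivFinOfCardEq hn), h, hF, trunc, if_pos hn]
  · rw [fam_homog_of_ne f hn, trunc, if_neg hn]

/-! ### Induction from block subgroups as a sum over stable decompositions -/

section Blocks

variable {n m d : ℕ} (h : n + m = d)

/-- The indicator of the first block. -/
def firstBlock (i : Fin d) : Bool := ((blocks h).symm i).isLeft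

theorem firstBlock_inl (a : Fin n) : firstBlock h (blocks h (Sum.inl a)) = true := by
  simp [firstBlock]

theorem firstBlock_inr (a : Fin m) : firstBlock h (blocks h (Sum.inr a)) = false := by
  simp [firstBlock]

/-- The first block. -/
def firstEquiv : {i // firstBlock h i = true} ≃ Fin n :=
  (Equiv.ofBijective (fun a : Fin n => (⟨blocks h (Sum.inl a), firstBlock_inl h a⟩ :
      {i // firstBlock h i = true})) ⟨fun a b hab => by
        simpa using congrArg Subtype.val hab, fun ⟨i, hi⟩ => by
        obtain ⟨j | j, rfl⟩ := (blocks h).surjective i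
        · exact ⟨j, rfl⟩
        · simp [firstBlock] at hi⟩).symm

/-- The second block. -/
def secondEquiv : {i // firstBlock h i = false} ≃ Fin m :=
  (Equiv.ofBijective (fun a : Fin m => (⟨blocks h (Sum.inr a), firstBlock_inr h a⟩ :
      {i // firstBlock h i = false})) ⟨fun a b hab => by
        simpa using congrArg Subtype.val hab, fun ⟨i, hi⟩ => by
        obtain ⟨j | j, rfl⟩ := (blocks h).surjective i
        · simp [firstBlock] at hi
        · exact ⟨j, rfl⟩⟩).symm

theorem splitEquiv_firstBlock :
    (Equiv.sumCongr (firstEquiv h) (secondEquiv h)).trans (blocks h) =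
      splitEquiv (firstBlock h) := by
  have h1 : blocks h =
      (Equiv.sumCongr (firstEquiv h).symm (secondEquiv h).symm).trans
        (splitEquiv (firstBlock h)) := by
    ext i
    rcases i with i | i <;> rfl
  rw [h1, ← Equiv.trans_assoc, Equiv.sumCongr_trans]
  simp

theorem stable_blockEmb (w : Wreath Γ n × Wreath Γ m) :
    WreathOn.Stable (blockEmb h w) (firstBlock h) := by
  intro i
  obtain ⟨j, rfl⟩ := (blocks h).surjective i
  rw [blockEmb_eq]
  simp only [firstBlock, map, Equiv.permCongr_apply, Equiv.symm_apply_apply]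
  rcases j with j | j <;> rfl

theorem blockEmb_res {x : Wreath Γ d} (hx : WreathOn.Stable x (firstBlock h)) :
    blockEmb h (map (firstEquiv h) (res x _ hx true), map (secondEquiv h) (res x _ hx false)) =
      x := by
  rw [blockEmb_eq]
  conv_rhs => rw [← map_join_res x _ hx, ← splitEquiv_firstBlock, ← map_map]
  congr 1
  ext i
  · rcases i with i | i <;> rfl
  · rcases i with i | i <;> rfl

theorem blockEmb_injective : Function.Injective (blockEmb (Γ := Γ) h) := by
  intro w w' hw
  rw [blockEmb_eq, blockEmb_eq] at hw
  have h1 : join w.1 w.2 = join w'.1 w'.2 := (mapEquiv (blocks h)).injective hw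
  refine Prod.ext ?_ ?_
  · ext a
    · exact congrFun (congrArg SemidirectProduct.left h1) (Sum.inl a)
    · exact congrArg Fin.val (Sum.inl.inj
        (Equiv.congr_fun (congrArg SemidirectProduct.right h1) (Sum.inl a)))
  · ext a
    · exact congrFun (congrArg SemidirectProduct.left h1) (Sum.inr a)
    · exact congrArg Fin.val (Sum.inr.inj
        (Equiv.congr_fun (congrArg SemidirectProduct.right h1) (Sum.inr a)))

variable [Fintype Γ] (f : ClassFn Γ n) (g : ClassFn Γ m)

open Classical in
/-- The class functions `f`, `g` on the block subgroup, extended by zero. -/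
def blockFn (x : Wreath Γ d) : K :=
  ∑ w : Wreath Γ n × Wreath Γ m, if x = blockEmb h w then f.1 w.1 * g.1 w.2 else 0

theorem blockFn_conj (w : Wreath Γ n × Wreath Γ m) (x : Wreath Γ d) :
    blockFn h f g ((blockEmb h w)⁻¹ * x * blockEmb h w) = blockFn h f g x := by
  unfold blockFn
  refine Fintype.sum_equiv (MulAut.conj w).toEquiv _ _ fun v => ?_
  have h1 : (blockEmb h w)⁻¹ * x * blockEmb h w = blockEmb h v ↔
      x = blockEmb h ((MulAut.conj w).toEquiv v) := by
    change _ ↔ x = blockEmb h (w * v * w⁻¹)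
    rw [map_mul, map_mul, _root_.map_inv, mul_assoc, inv_mul_eq_iff_eq_mul, eq_mul_inv_iff_mul_eq]
  by_cases hx : x = blockEmb h ((MulAut.conj w).toEquiv v)
  · rw [if_pos (h1.2 hx), if_pos hx, ← f.2 w.1 v.1, ← g.2 w.2 v.2]
    rfl
  · rw [if_neg fun h2 => hx (h1.1 h2), if_neg hx]

open Classical in
theorem blockFn_eq (x : Wreath Γ d) :
    blockFn h f g x = if hx : WreathOn.Stable x (firstBlock h) then
      fam (homog f) _ (res x _ hx true) * fam (homog g) _ (res x _ hx false) else 0 := by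
  unfold blockFn
  split_ifs with hx
  · rw [Finset.sum_eq_single
      (map (firstEquiv h) (res x _ hx true), map (secondEquiv h) (res x _ hx false))]
    · rw [if_pos (blockEmb_res h hx).symm, fam_homog f (firstEquiv h), fam_homog g (secondEquiv h)]
    · intro w _ hw
      refine if_neg fun h1 => hw ?_
      rw [← blockEmb_res h hx] at h1
      exact (blockEmb_injective h h1).symm
    · simp
  · refine Finset.sum_eq_zero fun w _ => if_neg fun h1 => hx ?_
    rw [h1]
    exact stable_blockEmb h w

-- When the parts of `p` have sizes n and m, the elements `y` in question form one coset of the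
-- block subgroup. By `blockFn_conj` the summand is constant on it, so its order appears as a
-- factor. For other sizes both sides vanish.
open Classical in
theorem sum_blockFn (x : Wreath Γ d) (p : Fin d → Bool) :
    (∑ y : Wreath Γ d, if p ∘ y.right = firstBlock h then blockFn h f g (y⁻¹ * x * y) else 0) =
      (Fintype.card (Wreath Γ n × Wreath Γ m) : K) * if hx : WreathOn.Stable x p then
      fam (homog f) _ (res x p hx true) * fam (homog g) _ (res x p hx false) else 0 := by
  by_cases hp : Fintype.card {a // p a = true} = n
  · have hp' : Fintype.card {a // p a = false} = m := by
      have h2 := Fintype.card_congr (splitEquiv p)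
      simp only [Fintype.card_sum, Fintype.card_fin] at h2
      omega
    obtain ⟨π, hπ⟩ : ∃ π : Equiv.Perm (Fin d), p ∘ π = firstBlock h := by
      refine ⟨((blocks h).symm.trans (Equiv.sumCongr (Fintype.equivFinOfCardEq hp).symm
        (Fintype.equivFinOfCardEq hp').symm)).trans (splitEquiv p), ?_⟩
      funext i
      obtain ⟨j, rfl⟩ := (blocks h).surjective i
      rcases j with j | j
      · simpa [firstBlock, splitEquiv] using ((Fintype.equivFinOfCardEq hp).symm j).2
      · simpa [firstBlock, splitEquiv] using ((Fintype.equivFinOfCardEq hp').symm j).2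
    -- A pure permutation carrying the standard blocks to the parts of `p`; it represents the coset.
    let y₀ : Wreath Γ d := ⟨1, π⟩
    have h3 : (∑ y : Wreath Γ d, if p ∘ y.right = firstBlock h then
        blockFn h f g (y⁻¹ * x * y) else 0) =
        ∑ w : Wreath Γ n × Wreath Γ m, blockFn h f g (y₀⁻¹ * x * y₀) := by
      rw [← Finset.sum_filter]
      symm
      refine Finset.sum_bij (fun w _ => y₀ * blockEmb h w) ?_ ?_ ?_ ?_
      · intro w _
        rw [Finset.mem_filter]
        refine ⟨Finset.mem_univ _, ?_⟩
        funext i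
        have h4 := stable_blockEmb h w i
        rw [← hπ] at h4 ⊢
        exact h4
      · intro w _ w' _ hw
        exact blockEmb_injective h (mul_left_cancel hw)
      · intro y hy
        rw [Finset.mem_filter] at hy
        have h5 : WreathOn.Stable (y₀⁻¹ * y) (firstBlock h) := by
          intro i
          rw [← hy.2]
          conv_lhs => rw [hy.2, ← hπ]
          simp [y₀]
        exact ⟨_, Finset.mem_univ _, by rw [blockEmb_res h h5, mul_inv_cancel_left]⟩
      · intro w _
        rw [← blockFn_conj h f g w]
        congr 1
        group
    have h6 : y₀⁻¹ * x * y₀ = map π.symm x := by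
      rw [map_perm]
      have : (⟨1, π.symm⟩ : Wreath Γ d) = y₀⁻¹ := by
        ext i <;> simp [y₀]
      rw [this, inv_inv]
    rw [h3, Finset.sum_const, Finset.card_univ, nsmul_eq_mul, h6, blockFn_eq]
    congr 1
    have h7 : firstBlock h ∘ π.symm = p := by
      rw [← hπ]; funext i; simp
    by_cases hx : (map π.symm x).Stable (firstBlock h)
    · have hx' := stable_map.1 hx
      rw [dif_pos hx, res_map hx, res_map hx, fam_invariant, fam_invariant]
      subst h7
      rw [dif_pos hx']
      rfl
    · rw [dif_neg hx, dif_neg]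
      rw [stable_map, h7] at hx
      exact hx
  · rw [Finset.sum_eq_zero]
    · symm
      rw [mul_eq_zero]
      right
      split_ifs with hx
      · rw [fam_homog_of_ne f hp, zero_mul]
      · rfl
    · intro y _
      refine if_neg fun h1 => hp ?_
      have h2 : {a // p (y.right a) = true} ≃ {a // p a = true} :=
        y.right.subtypeEquiv fun _ => Iff.rfl
      rw [← Fintype.card_congr h2]
      have h3 := Fintype.card_congr (firstEquiv h)
      rw [Fintype.card_fin] at h3
      rw [← h3]
      exact Fintype.card_congr (Equiv.subtypeEquivRight fun a => by rw [← h1]; rfl)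

/-- The sum over `y` in the induced function is sorted by the image under `y` of the first block.
Each image contributes one coset of the block subgroup, whose order cancels the normalisation. -/
theorem indProd_eq_conv (x : Wreath Γ d) :
    (indProd h f g).1 x = conv (fam (homog f)) (fam (homog g)) (Fin d) x := by
  classical
  have h1 : (indProd h f g).1 x = LaurentPolynomial.C
      ((Fintype.card (Wreath Γ n × Wreath Γ m) : ℂ)⁻¹) *
        ∑ y : Wreath Γ d, blockFn h f g (y⁻¹ * x * y) := by
    unfold blockFn
    congr!
  have h2 (y : Wreath Γ d) : blockFn h f g (y⁻¹ * x * y) = ∑ p : Fin d → Bool,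
      if p ∘ y.right = firstBlock h then blockFn h f g (y⁻¹ * x * y) else 0 := by
    rw [Finset.sum_eq_single (firstBlock h ∘ y.right.symm)]
    · rw [if_pos]
      funext i; simp
    · intro p _ hp
      refine if_neg fun h3 => hp ?_
      rw [← h3]; funext i; simp
    · simp
  rw [h1, conv_eq, Finset.sum_congr rfl fun y _ => h2 y, Finset.sum_comm,
    Finset.sum_congr rfl fun p _ => sum_blockFn h f g x p, ← Finset.mul_sum, ← mul_assoc,
    ← map_natCast (LaurentPolynomial.C (R := ℂ)), ← map_mul, inv_mul_cancel₀, map_one, one_mul]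
  exact_mod_cast Fintype.card_ne_zero

end Blocks

end Evaluation

/-! ### Creation and annihilation operators in terms of families -/

section Operators

variable {Γ : Type*} [Group Γ] {α β : Type}

open WreathOn
open Finset.HasAntidiagonal (antidiagonal)

/-- Composition with the inversion of the group. -/
def finv (F : Fam Γ) : Fam Γ := fun α _ x => F α x⁻¹

theorem Invariant.finv {F : Fam Γ} (hF : Invariant F) : Invariant (finv F) := by
  intro α β _ _ e x
  change F β (map e x)⁻¹ = F α x⁻¹
  rw [WreathOn.map_inv, hF]

theorem GroupLike.finv {F : Fam Γ} (hF : GroupLike F) : GroupLike (finv F) := by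
  intro α β _ _ x y
  change F _ (join x y)⁻¹ = F α x⁻¹ * F β y⁻¹
  rw [join_inv, hF]

theorem conv_add_right (F G G' : Fam Γ) : conv F (G + G') = conv F G + conv F G' := by
  funext α _ x
  simp only [conv, Pi.add_apply]
  rw [← Finset.sum_add_distrib]
  refine Finset.sum_congr rfl fun p _ => ?_
  split_ifs
  · rw [mul_add]
  · rw [add_zero]

theorem conv_zero_right (F : Fam Γ) : conv F 0 = 0 := by
  funext α _ x
  simp [conv]

variable [Fintype Γ]

theorem contr_add (φ : Fam Γ) (n : ℕ) (G G' : Fam Γ) :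
    contr φ n (G + G') = contr φ n G + contr φ n G' := by
  funext α _ x
  simp only [contr, Pi.add_apply]
  rw [avg_eq, avg_eq, avg_eq, ← mul_add, ← Finset.sum_add_distrib]
  simp only [mul_add]

theorem contr_zero (φ : Fam Γ) (n : ℕ) : contr φ n 0 = 0 := by
  funext α _ x
  simp [contr, avg]

theorem fam_creation_homog {n m : ℕ} (f : ClassFn Γ n) (g : ClassFn Γ m) :
    fam (homog (indProd rfl f g)) = conv (fam (homog f)) (fam (homog g)) := by
  funext α _ x
  by_cases h : Fintype.card α = n + m
  · rw [fam_homog _ (Fintype.equivFinOfCardEq h), indProd_eq_conv,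
      (fam_invariant _).conv (fam_invariant _)]
  · rw [fam_homog_of_ne _ h]
    refine (Finset.sum_eq_zero fun p _ => ?_).symm
    split_ifs with hx
    · by_cases h1 : Fintype.card {a // p a = true} = n
      · have h2 : Fintype.card {a // p a = false} ≠ m := by
          have := Fintype.card_congr (splitEquiv p)
          rw [Fintype.card_sum] at this
          omega
        rw [fam_homog_of_ne _ h2, mul_zero]
      · rw [fam_homog_of_ne _ h1, zero_mul]
    · rfl

theorem fam_creation {n : ℕ} (f : ClassFn Γ n) (u : RGr Γ) :
    fam (creation f u) = conv (fam (homog f)) (fam u) := by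
  induction u using DirectSum.induction_on with
  | zero =>
    rw [map_zero]
    exact (conv_zero_right _).symm
  | of m g =>
    refine Eq.trans ?_ (fam_creation_homog f g)
    congr 1
    exact DirectSum.toModule_lof _ _ _
  | add u v hu hv =>
    rw [map_add]
    change fam _ + fam _ = conv _ (fam _ + fam _)
    rw [hu, hv, conv_add_right]

/-- The form evaluates its second argument at x⁻¹, whereas `contr` evaluates at x; substituting x⁻¹
moves the inversion onto the weight, hence `finv`. -/
theorem fam_annihilation {n : ℕ} (e f : ClassFn Γ n) {φ : Fam Γ}
    (hφ : ∀ x, e.1 x * f.1 x = φ (Fin n) x) (u : RGr Γ) :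
    fam (annihilation e f u) = contr (finv φ) n (fam u) := by
  induction u using DirectSum.induction_on with
  | zero =>
    rw [map_zero]
    exact (contr_zero _ _).symm
  | of d g =>
    funext β _ y
    have h0 : contr (finv φ) n (fam (DirectSum.of (fun n => ClassFn Γ n) d g)) β y =
        avg fun x : Wreath Γ n => φ (Fin n) x * fam (homog g) (Fin n ⊕ β) (join x⁻¹ y) := by
      rw [← avg_inv]
      simp only [inv_inv]
      rfl
    have h1 : annihilation e f (DirectSum.of (fun n => ClassFn Γ n) d g) =
        (if h : n ≤ d then
          DirectSum.lof K ℕ (fun n => ClassFn Γ n) (d - n) ∘ₗ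
            contract (Nat.add_sub_cancel' h) e f else 0) g := DirectSum.toModule_lof _ _ _
    rw [h0, h1]
    by_cases hc : n + Fintype.card β = d
    · have h : n ≤ d := by omega
      have hβ : Fintype.card β = d - n := by omega
      rw [dif_pos h]
      change fam (homog (contract (Nat.add_sub_cancel' h) e f g)) β y = _
      rw [fam_homog _ (Fintype.equivFinOfCardEq hβ), avg_eq]
      change _ * ∑ x : Wreath Γ n, e.1 x * f.1 x * g.1 _ = _
      congr 1
      refine Finset.sum_congr rfl fun x _ => ?_
      rw [hφ, blockEmb_eq, fam_homog g ((Equiv.sumCongr (Equiv.refl _)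
        (Fintype.equivFinOfCardEq hβ)).trans (blocks (Nat.add_sub_cancel' h))), ← map_map,
        ← join_map_right]
    · have h2 : ∀ x : Wreath Γ n, fam (homog g) (Fin n ⊕ β) (join x⁻¹ y) = 0 := fun x =>
        fam_homog_of_ne g (by rwa [Fintype.card_sum, Fintype.card_fin]) _
      simp only [h2, mul_zero]
      rw [avg_eq, Finset.sum_const_zero, mul_zero]
      split_ifs with h
      · exact fam_homog_of_ne _ (by omega) _
      · rfl
  | add u v hu hv =>
    rw [map_add]
    change fam _ + fam _ = contr _ _ (fam _ + fam _)
    rw [hu, hv, contr_add]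

/-- The commutation relation between the contractions with a multiplicative family and the
multiplications by a multiplicative family. -/
theorem annih_mul_create {φ ψ : Fam Γ} (hφ : GroupLike φ) (hφ' : Invariant φ) (hψ : GroupLike ψ)
    (hψ' : Invariant ψ) {A C : ℕ → Module.End K (RGr Γ)}
    (hA : ∀ n u, fam (A n u) = contr φ n (fam u))
    (hC : ∀ n u, fam (C n u) = conv (trunc n ψ) (fam u)) (n m : ℕ) :
    A n * C m = ∑ a ∈ antidiagonal m, if a.1 ≤ n then
      avg (pmul φ ψ (Fin a.1)) • (C a.2 * A (n - a.1)) else 0 := by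
  refine LinearMap.ext fun u => fam_ext fun d x => ?_
  rw [Module.End.mul_apply, hA, hC, contr_conv hφ hφ' hψ hψ' (fam_invariant u),
    LinearMap.sum_apply, fam_sum]
  refine Finset.sum_congr rfl fun a _ => ?_
  split_ifs
  · rw [LinearMap.smul_apply, fam_smul, Module.End.mul_apply, hC, hA]
  · rfl

/-- All components of degree at least `N` vanish. -/
def DegLT (N : ℕ) (u : RGr Γ) : Prop := ∀ n ≥ N, u n = 0

omit [Fintype Γ] in
theorem DegLT.mono {N N' : ℕ} {u : RGr Γ} (hu : DegLT N u) (h : N ≤ N') : DegLT N' u :=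
  fun n hn => hu n (h.trans hn)

omit [Fintype Γ] in
theorem exists_degLT (u : RGr Γ) : ∃ N, DegLT N u := by
  classical
  refine ⟨(DFinsupp.support u).sup id + 1, fun n hn => ?_⟩
  by_contra h
  have := Finset.le_sup (f := id) (DFinsupp.mem_support_iff.2 h)
  simp only [id] at this
  omega

omit [Fintype Γ] in
theorem DegLT.fam_eq_zero {N : ℕ} {u : RGr Γ} (hu : DegLT N u) [Fintype α]
    (h : N ≤ Fintype.card α) (x : WreathOn Γ α) : fam u α x = 0 := by
  rw [fam, hu _ h]
  rfl

omit [Fintype Γ] in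
theorem DegLT.eq_sum {N : ℕ} {u : RGr Γ} (hu : DegLT N u) :
    u = ∑ d ∈ Finset.range N, homog (u d) := by
  refine fam_ext fun n x => ?_
  rw [fam_sum]
  by_cases hn : n < N
  · rw [Finset.sum_eq_single n, fam_fin, fam_homog _ (Equiv.refl _), map_refl]
    · intro d _ hd
      exact fam_homog_of_ne _ (by simpa using hd.symm) _
    · intro h
      exact absurd (Finset.mem_range.2 hn) h
  · rw [hu.fam_eq_zero (by simpa using hn)]
    refine (Finset.sum_eq_zero fun d hd => fam_homog_of_ne _ ?_ _).symm
    rw [Finset.mem_range] at hd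
    rw [Fintype.card_fin]
    omega

theorem contr_eq_zero {φ : Fam Γ} {N n : ℕ} {u : RGr Γ} (hu : DegLT N u) [Fintype β]
    (h : N ≤ n + Fintype.card β) (y : WreathOn Γ β) : contr φ n (fam u) β y = 0 := by
  have h1 (x : Wreath Γ n) : fam u (Fin n ⊕ β) (join x y) = 0 :=
    hu.fam_eq_zero (by simpa using h) _
  simp only [contr, h1, mul_zero]
  rw [avg_eq, Finset.sum_const_zero, mul_zero]

theorem DegLT.annih {φ : Fam Γ} {A : ℕ → Module.End K (RGr Γ)}
    (hA : ∀ n u, fam (A n u) = contr φ n (fam u)) {N : ℕ} {u : RGr Γ} (hu : DegLT N u) (n : ℕ) :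
    DegLT N (A n u) := by
  intro d hd
  refine Subtype.ext (funext fun x => ?_)
  rw [← fam_fin, hA, contr_eq_zero hu (by rw [Fintype.card_fin]; omega)]
  rfl

/-- On a fixed vector only finitely many annihilation operators act nontrivially; this makes all
later sums finite. -/
theorem DegLT.annih_eq_zero {φ : Fam Γ} {A : ℕ → Module.End K (RGr Γ)}
    (hA : ∀ n u, fam (A n u) = contr φ n (fam u)) {N n : ℕ} {u : RGr Γ} (hu : DegLT N u)
    (hn : N ≤ n) : A n u = 0 :=
  fam_ext fun d x => by rw [hA, fam_zero, contr_eq_zero hu (by omega)]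

omit [Fintype Γ] in
theorem degLT_homog {n : ℕ} (f : ClassFn Γ n) : DegLT (n + 1) (homog f) := fun d hd =>
  DirectSum.of_eq_of_ne _ _ _ (by omega)

end Operators

/-! ### Linear characters, tensor powers and the generating series of averages -/

section Characters

variable {Γ : Type*} [Group Γ] {α β : Type}

open WreathOn
open Finset.HasAntidiagonal (antidiagonal)

open Classical in
/-- The linear character `(g, σ) ↦ ∏ χ(g_a) sign(σ)^δ`, times `c ^ |α|`. -/
def lin (χ : Γ →* ℂˣ) (δ : ℕ) (c : K) : Fam Γ := fun α _ x =>
  c ^ Fintype.card α * ((∏ a, LaurentPolynomial.C ((χ (x.left a) : ℂˣ) : ℂ)) *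
    ((Equiv.Perm.sign x.right : ℤ) : K) ^ δ)

theorem lin_eq [Fintype α] [DecidableEq α] (χ : Γ →* ℂˣ) (δ : ℕ) (c : K) (x : WreathOn Γ α) :
    lin χ δ c α x = c ^ Fintype.card α * ((∏ a, LaurentPolynomial.C ((χ (x.left a) : ℂˣ) : ℂ)) *
      ((Equiv.Perm.sign x.right : ℤ) : K) ^ δ) := by
  unfold lin
  congr!

theorem lin_invariant (χ : Γ →* ℂˣ) (δ : ℕ) (c : K) : Invariant (lin χ δ c) := by
  intro α β _ _ e x
  classical
  rw [lin_eq, lin_eq, Fintype.card_congr e]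
  congr 2
  · exact Fintype.prod_equiv e.symm _ _ fun b => rfl
  · rw [map, Equiv.Perm.sign_permCongr]

theorem lin_groupLike (χ : Γ →* ℂˣ) (δ : ℕ) (c : K) : GroupLike (lin χ δ c) := by
  intro α β _ _ x y
  classical
  rw [lin_eq, lin_eq, lin_eq, Fintype.card_sum, Fintype.prod_sum_type, pow_add]
  simp only [join, Equiv.Perm.sign_sumCongr, Sum.elim_inl, Sum.elim_inr, Units.val_mul,
    Int.cast_mul, mul_pow]
  ring

/-- Only χ is inverted: the sign is its own inverse, and the scalar depends on the degree alone, so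
powers of q keep their exponents. -/
theorem finv_lin (χ : Γ →* ℂˣ) (δ : ℕ) (c : K) : finv (lin χ δ c) = lin χ⁻¹ δ c := by
  classical
  funext α _ x
  rw [finv, lin_eq, lin_eq]
  congr 2
  · refine Fintype.prod_equiv x.right _ _ fun a => ?_
    have h : (x⁻¹).left a = (x.left (x.right a))⁻¹ := by
      rw [SemidirectProduct.inv_left, mulAutArrow_on]
      simp
    rw [h, _root_.map_inv, MonoidHom.inv_apply]
  · rw [SemidirectProduct.inv_right, Equiv.Perm.sign_inv]

theorem pmul_lin (χ χ' : Γ →* ℂˣ) (δ δ' : ℕ) (c c' : K) :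
    pmul (lin χ δ c) (lin χ' δ' c') = lin (χ * χ') (δ + δ') (c * c') := by
  classical
  funext α _ x
  rw [pmul, lin_eq, lin_eq, lin_eq, mul_pow, pow_add]
  simp only [MonoidHom.mul_apply, Units.val_mul, map_mul, Finset.prod_mul_distrib]
  ring

/-- The unit of the induction product. -/
def unitFam : Fam Γ := fun α _ _ => if Fintype.card α = 0 then 1 else 0

theorem pmul_lin_unitFam (χ : Γ →* ℂˣ) (δ : ℕ) (c : K) : pmul (lin χ δ c) unitFam = unitFam := by
  classical
  funext α _ x
  rw [pmul, unitFam]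
  split_ifs with h
  · have : IsEmpty α := Fintype.card_eq_zero_iff.1 h
    rw [lin_eq, h, Subsingleton.elim x.right 1]
    simp
  · rw [mul_zero]

theorem conv_unitFam {F : Fam Γ} (hF : Invariant F) : conv F unitFam = F := by
  classical
  funext α _ x
  rw [conv_eq, Finset.sum_eq_single fun _ => true]
  · have hx : x.Stable fun _ => true := fun _ => rfl
    rw [dif_pos hx, unitFam, if_pos (by simp), mul_one,
      ← hF (Equiv.subtypeUnivEquiv fun _ => rfl)]
    rfl
  · intro p _ hp
    split_ifs with h
    · rw [unitFam, if_neg, mul_zero]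
      intro h0
      have := Fintype.card_eq_zero_iff.1 h0
      refine hp (funext fun a => ?_)
      by_contra ha
      exact this.false ⟨a, by simpa using ha⟩
    · rfl
  · simp

theorem unitFam_conv {F : Fam Γ} (hF : Invariant F) : conv unitFam F = F := by
  classical
  funext α _ x
  rw [conv_eq, Finset.sum_eq_single fun _ => false]
  · have hx : x.Stable fun _ => false := fun _ => rfl
    rw [dif_pos hx, unitFam, if_pos (by simp), one_mul,
      ← hF (Equiv.subtypeUnivEquiv fun _ => rfl)]
    rfl
  · intro p _ hp
    split_ifs with h
    · rw [unitFam, if_neg, zero_mul]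
      intro h0
      have := Fintype.card_eq_zero_iff.1 h0
      refine hp (funext fun a => ?_)
      by_contra ha
      exact this.false ⟨a, by simpa using ha⟩
    · rfl
  · simp

open Classical in
/-- The characters of the tensor powers of `V`. -/
def tens (V : TRep Γ) : Fam Γ := fun α _ x =>
  ∑ j : α → Fin V.dim, if j ∘ x.right = j then
    ∏ a, LaurentPolynomial.C ((V.chi (j a) (x.left a) : ℂˣ) : ℂ) * qPow (V.wt (j a)) else 0

theorem tens_eq [Fintype α] [DecidableEq α] (V : TRep Γ) (x : WreathOn Γ α) :
    tens V α x = ∑ j : α → Fin V.dim, if j ∘ x.right = j then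
      ∏ a, LaurentPolynomial.C ((V.chi (j a) (x.left a) : ℂˣ) : ℂ) * qPow (V.wt (j a)) else 0 := by
  unfold tens
  congr!

theorem tens_invariant (V : TRep Γ) : Invariant (tens V) := by
  intro α β _ _ e x
  classical
  rw [tens_eq, tens_eq]
  refine Fintype.sum_equiv (Equiv.arrowCongr e (Equiv.refl _)).symm _ _ fun j => ?_
  have hj : (Equiv.arrowCongr e (Equiv.refl _)).symm j = j ∘ e := rfl
  have h1 : j ∘ (map e x).right = j ↔ (j ∘ e) ∘ x.right = j ∘ e := by
    rw [← e.surjective.injective_comp_right.eq_iff]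
    have : (j ∘ (map e x).right) ∘ e = (j ∘ e) ∘ x.right := by
      funext a; simp [map]
    rw [this]
  rw [hj]
  simp only [h1]
  split_ifs
  · exact Fintype.prod_equiv e.symm _ _ fun b => by simp [map]
  · rfl

theorem tensorChar_eq_tens (V : TRep Γ) (n : ℕ) (x : Wreath Γ n) :
    (V.tensorChar n).1 x = tens V (Fin n) x := by
  classical
  rw [tens_eq]
  change ∑ j : Fin n → Fin V.dim, ∏ i, V.act (x.left i) (j i) (j (x.right⁻¹ i)) = _
  simp only [TRep.prod_act_eq]

theorem tens_single (χ : Γ →* ℂˣ) (k : ℤ) : tens (TRep.single χ k) = lin χ 0 (qPow k) := by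
  classical
  funext α _ x
  rw [tens_eq, lin_eq]
  change ∑ j : α → Fin 1, (if j ∘ x.right = j then
    ∏ a, LaurentPolynomial.C ((χ (x.left a) : ℂˣ) : ℂ) * qPow k else 0) = _
  rw [Fintype.sum_unique, if_pos (Subsingleton.elim _ _), Finset.prod_mul_distrib,
    Finset.prod_const, Finset.card_univ]
  ring

theorem tens_zero : tens (TRep.zero : TRep Γ) = unitFam := by
  classical
  funext α _ x
  rw [tens_eq, unitFam]
  change ∑ j : α → Fin 0, (if j ∘ x.right = j then ∏ a, _ else 0) = _
  split_ifs with h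
  · have : IsEmpty α := Fintype.card_eq_zero_iff.1 h
    rw [Fintype.sum_unique, if_pos (Subsingleton.elim _ _), Finset.univ_eq_empty,
      Finset.prod_empty]
  · have : Nonempty α := Fintype.card_pos_iff.1 (Nat.pos_of_ne_zero h)
    exact Fintype.sum_empty _

/-- A basis tensor contributes to the trace exactly when its colouring by the two summands is fixed
by the permutation, i.e. when it is a stable decomposition. The second summand comes first because
`finTwoEquiv` sends 1 to `true`. -/
theorem tens_two (χ χ' : Γ →* ℂˣ) (k k' : ℤ) :
    tens (⟨2, ![χ, χ'], ![k, k']⟩ : TRep Γ) =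
      conv (lin χ' 0 (qPow k')) (lin χ 0 (qPow k)) := by
  classical
  funext α _ x
  rw [tens_eq, conv_eq]
  refine Fintype.sum_equiv (Equiv.arrowCongr (Equiv.refl α) finTwoEquiv) _ _ fun j => ?_
  obtain ⟨p, rfl⟩ := (Equiv.arrowCongr (Equiv.refl α) finTwoEquiv).symm.surjective j
  rw [Equiv.apply_symm_apply]
  have hp : (Equiv.arrowCongr (Equiv.refl α) finTwoEquiv).symm p = finTwoEquiv.symm ∘ p := rfl
  rw [hp]
  by_cases h : x.Stable p
  · have h1 : (finTwoEquiv.symm ∘ p) ∘ x.right = finTwoEquiv.symm ∘ p := by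
      funext a; simp [h a]
    rw [if_pos h1, dif_pos h, lin_eq, lin_eq, ← Equiv.prod_comp (splitEquiv p),
      Fintype.prod_sum_type]
    have h2 : ∀ a : {a // p a = true}, p (splitEquiv p (Sum.inl a)) = true := fun a => a.2
    have h3 : ∀ a : {a // p a = false}, p (splitEquiv p (Sum.inr a)) = false := fun a => a.2
    simp only [Function.comp_apply, h2, h3]
    rw [Finset.prod_mul_distrib, Finset.prod_mul_distrib, pow_zero, pow_zero, mul_one, mul_one,
      mul_comm (qPow k' ^ _), mul_comm (qPow k ^ _)]
    congr 2
    · simp [finTwoEquiv]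
    · simp [finTwoEquiv]
  · rw [dif_neg h, if_neg]
    intro h1
    refine h fun a => finTwoEquiv.symm.injective (congrFun h1 a)

/-- The family `η(X)`. -/
def etaFam (X : VRep Γ) : Fam Γ := conv (tens X.pos) (pmul (lin 1 1 (-1)) (tens X.neg))

theorem etaFam_invariant (X : VRep Γ) : Invariant (etaFam X) :=
  (tens_invariant _).conv ((lin_invariant _ _ _).pmul (tens_invariant _))

/-- Each decomposition is counted at exactly one `m`, the size of its part marked `false`. -/
theorem conv_eq_sum_trunc (F G : Fam Γ) (n : ℕ) (x : Wreath Γ n) :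
    conv F G (Fin n) x =
      ∑ m : Fin (n + 1), conv (trunc (n - m) F) (trunc m G) (Fin n) x := by
  classical
  simp only [conv_eq]
  rw [Finset.sum_comm]
  refine Finset.sum_congr rfl fun p _ => ?_
  by_cases h : WreathOn.Stable x p
  · have h1 := Fintype.card_congr (splitEquiv p)
    rw [Fintype.card_sum, Fintype.card_fin] at h1
    simp only [h, dif_pos]
    rw [Finset.sum_eq_single (⟨Fintype.card {a // p a = false}, by omega⟩ : Fin (n + 1))]
    · rw [trunc, trunc, if_pos (by simp only; omega), if_pos rfl]
    · intro m _ hm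
      rw [trunc, trunc, if_neg (c := Fintype.card {a // p a = false} = m), mul_zero]
      exact fun h2 => hm (Fin.ext h2.symm)
    · simp
  · simp [h]

theorem conv_smul_right (c : K) (F G : Fam Γ) : conv F (c • G) = c • conv F G := by
  funext α _ x
  simp only [conv, Pi.smul_apply, smul_eq_mul]
  rw [Finset.mul_sum]
  refine Finset.sum_congr rfl fun p _ => ?_
  split_ifs
  · rw [mul_left_comm]
  · rw [mul_zero]

variable [Fintype Γ]

/-- The factor (-1)^m and the sign twist of the subtracted part together form the multiplicative
family `lin 1 1 (-1)`, so the alternating sum defining η is a single induction product. -/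
theorem eta_eq (X : VRep Γ) (n : ℕ) (x : Wreath Γ n) : (eta X n).1 x = etaFam X (Fin n) x := by
  classical
  rw [etaFam, conv_eq_sum_trunc, eta, AddSubmonoidClass.coe_finsetSum, Finset.sum_apply]
  refine Finset.sum_congr rfl fun m _ => ?_
  rw [SetLike.val_smul, Pi.smul_apply, indProd_eq_conv,
    fam_homog_eq_trunc _ (tens_invariant X.pos) (tensorChar_eq_tens _ _),
    fam_homog_eq_trunc (signTwist (X.neg.tensorChar m)) (F := pmul (lin 1 1 1) (tens X.neg))
      ((lin_invariant _ _ _).pmul (tens_invariant _))]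
  · have h1 : trunc m (pmul (lin 1 1 (-1)) (tens X.neg)) =
        ((-1 : K) ^ (m : ℕ)) • trunc m (pmul (lin 1 1 1) (tens X.neg)) := by
      funext α _ x
      simp only [trunc, pmul, Pi.smul_apply, smul_eq_mul]
      split_ifs with h
      · rw [lin_eq, lin_eq, h]
        ring
      · rw [mul_zero]
    rw [h1, conv_smul_right]
    rfl
  · intro y
    rw [pmul, lin_eq, ← tensorChar_eq_tens]
    simp [signTwist]

theorem eps_eq (X : VRep Γ) (n : ℕ) (x : Wreath Γ n) :
    (eps X n).1 x = pmul (lin 1 1 1) (etaFam X) (Fin n) x := by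
  rw [pmul, lin_eq, ← eta_eq]
  simp [eps, signTwist]

/-- The generating series of the averages. -/
def avgSeries (F : Fam Γ) : PowerSeries K := PowerSeries.mk fun n => avg (F (Fin n))

/-- This form of `avg_conv` reduces the contraction function to its four linear factors. -/
theorem avgSeries_conv {F G : Fam Γ} (hF : Invariant F) (hG : Invariant G) :
    avgSeries (conv F G) = avgSeries F * avgSeries G := by
  ext1 n
  rw [avgSeries, PowerSeries.coeff_mk, avg_conv hF hG, PowerSeries.coeff_mul]
  simp only [avgSeries, PowerSeries.coeff_mk]

theorem sum_lin (χ : Γ →* ℂˣ) (δ : ℕ) (c : K) (n : ℕ) :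
    ∑ x : Wreath Γ n, lin χ δ c (Fin n) x = c ^ n * (LaurentPolynomial.C
      ((∑ g : Γ, ((χ g : ℂˣ) : ℂ)) ^ n * ∑ σ : Equiv.Perm (Fin n),
        ((Equiv.Perm.sign σ : ℤ) : ℂ) ^ δ)) := by
  have h1 : (∑ g : Γ, ((χ g : ℂˣ) : ℂ)) ^ n = ∑ g : Fin n → Γ, ∏ a, ((χ (g a) : ℂˣ) : ℂ) := by
    rw [← Fintype.piFinset_univ, Finset.sum_prod_piFinset Finset.univ
      fun (_ : Fin n) g => ((χ g : ℂˣ) : ℂ)]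
    simp
  rw [h1, ← Equiv.sum_comp SemidirectProduct.equivProd.symm, Fintype.sum_prod_type,
    Finset.sum_mul_sum, map_sum, Finset.mul_sum]
  refine Finset.sum_congr rfl fun g _ => ?_
  rw [map_sum, Finset.mul_sum]
  refine Finset.sum_congr rfl fun σ _ => ?_
  rw [lin_eq, Fintype.card_fin, map_mul, map_pow, map_intCast, map_prod]
  rfl

/-- A linear character splits over Γ^n and S_n, and orthogonality on each copy of Γ kills nontrivial
χ. In degree 0 the convention 0^0 = 1 gives the correct value 1. -/
theorem avg_lin (χ : Γ →* ℂˣ) (δ : ℕ) (c : K) (n : ℕ) :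
    avg (lin χ δ c (Fin n)) = c ^ n * (LaurentPolynomial.C
      ((if χ = 1 then 1 else 0) ^ n * ((n.factorial : ℂ)⁻¹ * ∑ σ : Equiv.Perm (Fin n),
        ((Equiv.Perm.sign σ : ℤ) : ℂ) ^ δ))) := by
  classical
  have h := sum_hom_units ((Units.coeHom ℂ).comp χ)
  simp only [MonoidHom.comp_apply, Units.coeHom_apply] at h
  have h2 : (Units.coeHom ℂ).comp χ = 1 ↔ χ = 1 := by
    constructor
    · intro h3
      ext x
      simpa using DFunLike.congr_fun h3 x
    · rintro rfl
      ext x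
      simp
  have h6 : (Fintype.card Γ : ℂ) ≠ 0 := by
    exact_mod_cast Fintype.card_ne_zero
  rw [avg_eq, sum_lin, mul_left_comm, ← map_mul, h, card_eq, Fintype.card_fin]
  simp only [h2]
  congr 2
  push_cast
  split_ifs with h3
  · field_simp
    rw [one_pow, mul_one]
  · rcases n with _ | n
    · simp
    · simp

theorem sum_sign_pow_even {δ : ℕ} (hδ : Even δ) (n : ℕ) :
    ∑ σ : Equiv.Perm (Fin n), ((Equiv.Perm.sign σ : ℤ) : ℂ) ^ δ = n.factorial := by
  have h (σ : Equiv.Perm (Fin n)) : ((Equiv.Perm.sign σ : ℤ) : ℂ) ^ δ = 1 := by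
    obtain ⟨k, rfl⟩ := hδ
    rcases Int.units_eq_one_or (Equiv.Perm.sign σ) with h | h <;> simp [h, ← two_mul, pow_mul]
  simp [h, Fintype.card_perm]

theorem sum_sign_pow_odd {δ : ℕ} (hδ : Odd δ) (n : ℕ) :
    ∑ σ : Equiv.Perm (Fin n), ((Equiv.Perm.sign σ : ℤ) : ℂ) ^ δ = if n ≤ 1 then 1 else 0 := by
  have h (σ : Equiv.Perm (Fin n)) : ((Equiv.Perm.sign σ : ℤ) : ℂ) ^ δ =
      ((Equiv.Perm.sign σ : ℤ) : ℂ) := by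
    rcases Int.units_eq_one_or (Equiv.Perm.sign σ) with h | h <;> simp [h, hδ.neg_one_pow]
  simp only [h]
  split_ifs with hn
  · have : Subsingleton (Fin n) := Fin.subsingleton_iff_le_one.2 hn
    rw [Fintype.sum_unique]
    simp
  · have hne : (⟨0, by omega⟩ : Fin n) ≠ ⟨1, by omega⟩ := by simp
    -- Right multiplication by a transposition negates every sign, so the sum equals its own
    -- negative.
    have h1 := Equiv.sum_comp (Equiv.mulRight (Equiv.swap (⟨0, by omega⟩ : Fin n) ⟨1, by omega⟩))
      (fun σ : Equiv.Perm (Fin n) => ((Equiv.Perm.sign σ : ℤ) : ℂ))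
    simp only [Equiv.coe_mulRight, Equiv.Perm.sign_mul, Equiv.Perm.sign_swap hne, mul_neg, mul_one,
      Units.val_neg, Int.cast_neg, Finset.sum_neg_distrib] at h1
    exact self_eq_neg.1 h1.symm

theorem avgSeries_lin_of_ne {χ : Γ →* ℂˣ} (h : χ ≠ 1) (δ : ℕ) (c : K) :
    avgSeries (lin χ δ c) = 1 := by
  ext1 n
  rw [avgSeries, PowerSeries.coeff_mk, avg_lin, if_neg h, PowerSeries.coeff_one]
  rcases n with _ | n
  · simp
  · simp

theorem avgSeries_lin_even {δ : ℕ} (h : Even δ) (c : K) :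
    avgSeries (lin (1 : Γ →* ℂˣ) δ c) = PowerSeries.mk fun n => c ^ n := by
  ext1 n
  rw [avgSeries, PowerSeries.coeff_mk, PowerSeries.coeff_mk, avg_lin, if_pos rfl,
    sum_sign_pow_even h, inv_mul_cancel₀ (by exact_mod_cast n.factorial_ne_zero)]
  simp

theorem avgSeries_lin_odd {δ : ℕ} (h : Odd δ) (c : K) :
    avgSeries (lin (1 : Γ →* ℂˣ) δ c) = 1 + PowerSeries.C c * PowerSeries.X := by
  ext1 n
  rw [avgSeries, PowerSeries.coeff_mk, avg_lin, if_pos rfl, sum_sign_pow_odd h]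
  rcases n with _ | _ | n
  · simp
  · simp [PowerSeries.coeff_one]
  · simp [PowerSeries.coeff_one]

end Characters

/-! ### Multiplication of two-variable formal series by power series in w/z -/

section FormalSeries

open Finset.HasAntidiagonal (antidiagonal)

variable {M : Type*} [AddCommGroup M] [Module K M]

/-- Multiplication of `∑ X a b z^a w^b` by the power series `f` in `w / z`. -/
def seriesMul (f : PowerSeries K) (X : ℤ → ℤ → M) : ℤ → ℤ → M :=
  fun a b => ∑ᶠ n : ℕ, PowerSeries.coeff n f • X (a + n) (b - n)

/-- The lower bound on powers of w makes the support finite, so the default value of `finsum` never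
intervenes and any large `N` may be used. -/
theorem seriesMul_eq_sum (f : PowerSeries K) {X : ℤ → ℤ → M} {B : ℤ}
    (hB : ∀ a b, b < B → X a b = 0) {N : ℕ} {a b : ℤ} (hN : b - N < B) :
    seriesMul f X a b = ∑ n ∈ Finset.range N, PowerSeries.coeff n f • X (a + n) (b - n) := by
  refine finsum_eq_sum_of_support_subset _ fun n hn => ?_
  by_contra hcon
  apply hn
  simp only [Finset.coe_range, Set.mem_Iio, not_lt] at hcon
  change PowerSeries.coeff n f • X (a + n) (b - n) = 0
  rw [hB _ _ (by omega), smul_zero]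

theorem seriesMul_lt (f : PowerSeries K) {X : ℤ → ℤ → M} {B : ℤ}
    (hB : ∀ a b, b < B → X a b = 0) (a b : ℤ) (hb : b < B) : seriesMul f X a b = 0 := by
  rw [seriesMul_eq_sum f hB (N := 0) (by simpa using hb), Finset.sum_range_zero]

/-- The triangle k + l < N lies in the square, and the remaining terms vanish. It serves both for
products of power series and for exchanging the order of the operators. -/
theorem sum_antidiagonal_eq_sum_square {M : Type*} [AddCommMonoid M] (N : ℕ) (T : ℕ → ℕ → M)
    (hT : ∀ k l, N ≤ k + l → T k l = 0) :
    ∑ n ∈ Finset.range N, ∑ p ∈ antidiagonal n, T p.1 p.2 =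
      ∑ k ∈ Finset.range N, ∑ l ∈ Finset.range N, T k l := by
  have h0 : ∑ p ∈ (Finset.range N ×ˢ Finset.range N).filter fun p : ℕ × ℕ => ¬ p.1 + p.2 < N,
      T p.1 p.2 = 0 :=
    Finset.sum_eq_zero fun p hp => hT _ _ (by simpa using (Finset.mem_filter.1 hp).2)
  rw [← Finset.sum_product', ← Finset.sum_filter_add_sum_filter_not _
    fun p : ℕ × ℕ => p.1 + p.2 < N,
    h0, add_zero,
    ← Finset.sum_fiberwise_of_maps_to (t := Finset.range N) (g := fun p : ℕ × ℕ => p.1 + p.2)]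
  · refine Finset.sum_congr rfl fun n hn => Finset.sum_congr ?_ fun _ _ => rfl
    ext ⟨k, l⟩
    simp only [Finset.mem_range, Finset.HasAntidiagonal.mem_antidiagonal, Finset.mem_filter,
      Finset.mem_product] at *
    omega
  · intro p hp
    simpa using (Finset.mem_filter.1 hp).2

theorem seriesMul_mul (f g : PowerSeries K) {X : ℤ → ℤ → M} (hX : BoundedBelow X) :
    seriesMul (f * g) X = seriesMul f (seriesMul g X) := by
  obtain ⟨B, hB⟩ := hX
  funext a b
  obtain ⟨N, hN⟩ : ∃ N : ℕ, b - N < B := ⟨(b - B).toNat + 1, by omega⟩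
  rw [seriesMul_eq_sum _ hB hN, seriesMul_eq_sum _ (seriesMul_lt g hB) hN]
  have h1 (k : ℕ) : seriesMul g X (a + k) (b - k) = ∑ l ∈ Finset.range N,
      PowerSeries.coeff l g • X (a + k + l) (b - k - l) := seriesMul_eq_sum _ hB (by omega)
  simp only [h1, Finset.smul_sum]
  rw [← sum_antidiagonal_eq_sum_square N fun k l => PowerSeries.coeff k f •
    PowerSeries.coeff l g • X (a + k + l) (b - k - l)]
  · refine Finset.sum_congr rfl fun n _ => ?_
    rw [PowerSeries.coeff_mul, Finset.sum_smul]
    refine Finset.sum_congr rfl fun p hp => ?_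
    rw [Finset.HasAntidiagonal.mem_antidiagonal] at hp
    rw [mul_smul, ← hp]
    congr 3 <;> push_cast <;> ring
  · intro k l hkl
    rw [hB _ _ (by omega), smul_zero, smul_zero]

theorem seriesMul_one (X : ℤ → ℤ → M) : seriesMul 1 X = X := by
  funext a b
  rw [seriesMul, finsum_eq_single _ 0]
  · simp
  · intro n hn
    rw [PowerSeries.coeff_one, if_neg hn, zero_smul]

theorem seriesMul_shift (f : PowerSeries K) (X : ℤ → ℤ → M) (t a b : ℤ) :
    seriesMul f (fun a b => X (a + t) b) a b = seriesMul f X (a + t) b := by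
  unfold seriesMul
  refine finsum_congr fun n => ?_
  rw [add_right_comm]

theorem seriesMul_add (f : PowerSeries K) {X Y : ℤ → ℤ → M} (hX : BoundedBelow X)
    (hY : BoundedBelow Y) (a b : ℤ) :
    seriesMul f (fun a b => X a b + Y a b) a b = seriesMul f X a b + seriesMul f Y a b := by
  obtain ⟨B, hB⟩ := hX
  obtain ⟨B', hB'⟩ := hY
  obtain ⟨N, hN, hN'⟩ : ∃ N : ℕ, b - N < B ∧ b - N < B' :=
    ⟨(b - B).toNat + (b - B').toNat + 1, by omega, by omega⟩
  have h : ∀ a b, b < min B B' → X a b + Y a b = 0 := fun a b hb => by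
    rw [hB _ _ (lt_of_lt_of_le hb (min_le_left _ _)),
      hB' _ _ (lt_of_lt_of_le hb (min_le_right _ _)),
      add_zero]
  rw [seriesMul_eq_sum _ hB hN, seriesMul_eq_sum _ hB' hN',
    seriesMul_eq_sum (X := fun a b => X a b + Y a b) _ h (lt_min hN hN'),
    ← Finset.sum_add_distrib]
  simp only [smul_add]

theorem seriesMul_map {M' : Type*} [AddCommGroup M'] [Module K M'] (f : PowerSeries K)
    {X : ℤ → ℤ → M} (hX : BoundedBelow X) (L : M →ₗ[K] M') (a b : ℤ) :
    seriesMul f (fun a b => L (X a b)) a b = L (seriesMul f X a b) := by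
  obtain ⟨B, hB⟩ := hX
  obtain ⟨N, hN⟩ : ∃ N : ℕ, b - N < B := ⟨(b - B).toNat + 1, by omega⟩
  rw [seriesMul_eq_sum _ hB hN, seriesMul_eq_sum (X := fun a b => L (X a b)) _
    (fun a b hb => by rw [hB a b hb, map_zero]) hN, map_sum]
  simp only [map_smul]

/-- Write z - cw = z(1 - c w/z); the leading z is the shift by one in the first index. -/
theorem mulLin_eq_seriesMul (c : K) (X : ℤ → ℤ → M) (a b : ℤ) :
    mulLin c X a b = seriesMul (1 - PowerSeries.C c * PowerSeries.X) X (a - 1) b := by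
  rw [seriesMul, finsum_eq_sum_of_support_subset (s := {0, 1})]
  · rw [Finset.sum_pair zero_ne_one, mulLin]
    simp [PowerSeries.coeff_one, sub_eq_add_neg]
  · intro n hn
    by_contra hcon
    apply hn
    simp only [Finset.coe_insert, Finset.coe_singleton, Set.mem_insert_iff, Set.mem_singleton_iff,
      not_or] at hcon
    obtain ⟨m, rfl⟩ : ∃ m, n = m + 2 := ⟨n - 2, by omega⟩
    simp [PowerSeries.coeff_one]

theorem divLin_eq_seriesMul (c : K) (X : ℤ → ℤ → M) (a b : ℤ) :
    divLin c X a b = seriesMul (PowerSeries.mk fun n => c ^ n) X (a + 1) b := by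
  rw [seriesMul, divLin]
  simp only [PowerSeries.coeff_mk]

theorem mulLin_mulLin_eq_seriesMul (c c' : K) {X : ℤ → ℤ → M} (hX : BoundedBelow X) (a b : ℤ) :
    mulLin c (mulLin c' X) a b = seriesMul ((1 - PowerSeries.C c * PowerSeries.X) *
      (1 - PowerSeries.C c' * PowerSeries.X)) X (a - 2) b := by
  have h : mulLin c' X = fun a b =>
      seriesMul (1 - PowerSeries.C c' * PowerSeries.X) X (a + -1) b :=
    funext fun a => funext fun b => mulLin_eq_seriesMul c' X a b
  rw [mulLin_eq_seriesMul, h, seriesMul_shift, seriesMul_mul _ _ hX]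
  congr 1
  ring

theorem divLin_divLin_eq_seriesMul (c c' : K) {X : ℤ → ℤ → M} (hX : BoundedBelow X) (a b : ℤ) :
    divLin c (divLin c' X) a b = seriesMul ((PowerSeries.mk fun n => c ^ n) *
      (PowerSeries.mk fun n => c' ^ n)) X (a + 2) b := by
  have h : divLin c' X = fun a b => seriesMul (PowerSeries.mk fun n => c' ^ n) X (a + 1) b :=
    funext fun a => funext fun b => divLin_eq_seriesMul c' X a b
  rw [divLin_eq_seriesMul, h, seriesMul_shift, seriesMul_mul _ _ hX]
  congr 1
  ring

end FormalSeries

/-! ### Products of vertex operators from the contraction of their halves -/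

section VertexOperators

open Finset.HasAntidiagonal (antidiagonal)

variable {r : ℕ} {Γ : Type*} [Group Γ] [Fintype Γ]

omit [Fintype Γ] in
theorem coeffAt_of_neg (S : ℕ → Module.End K (RGr Γ)) {n : ℤ} (h : n < 0) : coeffAt S n = 0 :=
  if_neg (by omega)

omit [Fintype Γ] in
theorem coeffAt_natCast (S : ℕ → Module.End K (RGr Γ)) (n : ℕ) : coeffAt S n = S n :=
  if_pos (by omega)

/-- The definition cuts the sum at a bound depending on each homogeneous degree; since larger
annihilation indices give zero, one uniform bound works for the whole vector. -/
theorem halves_eq {D : VertexData r Γ} {φ : Fam Γ}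
    (hA : ∀ n u, fam (D.annih n u) = contr φ n (fam u)) {N : ℕ} {u : RGr Γ} (hu : DegLT N u)
    (a : ℤ) :
    halves D a u = ∑ m ∈ Finset.range N, coeffAt D.create (a + m) (D.annih m u) := by
  have h1 (d : ℕ) (hd : d < N) : halves D a (homog (u d)) =
      ∑ m ∈ Finset.range N, coeffAt D.create (a + m) (D.annih m (homog (u d))) := by
    have h2 : halves D a (homog (u d)) = (∑ m ∈ Finset.range (d + 1),
        coeffAt D.create (a + m) * D.annih m) (homog (u d)) := DirectSum.toModule_lof _ _ _
    rw [h2, LinearMap.sum_apply]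
    refine Finset.sum_subset (Finset.range_subset_range.2 hd) fun m _ hm => ?_
    rw [Finset.mem_range] at hm
    rw [Module.End.mul_apply, (degLT_homog (u d)).annih_eq_zero hA (by omega), map_zero]
  conv_lhs => rw [hu.eq_sum, map_sum]
  rw [Finset.sum_congr rfl fun d hd => h1 d (Finset.mem_range.1 hd), Finset.sum_comm]
  refine Finset.sum_congr rfl fun m _ => ?_
  conv_rhs => rw [hu.eq_sum, map_sum, map_sum]

theorem halves₂_eq {D D' : VertexData r Γ} {φ φ' : Fam Γ}
    (hA : ∀ n u, fam (D.annih n u) = contr φ n (fam u))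
    (hA' : ∀ n u, fam (D'.annih n u) = contr φ' n (fam u)) {N : ℕ} {u : RGr Γ} (hu : DegLT N u)
    (a b : ℤ) :
    halves₂ D D' a b u = ∑ m ∈ Finset.range N, ∑ m' ∈ Finset.range N,
      coeffAt D.create (a + m) (coeffAt D'.create (b + m') (D.annih m (D'.annih m' u))) := by
  have h1 (d : ℕ) (hd : d < N) : halves₂ D D' a b (homog (u d)) =
      ∑ m ∈ Finset.range N, ∑ m' ∈ Finset.range N, coeffAt D.create (a + m)
        (coeffAt D'.create (b + m') (D.annih m (D'.annih m' (homog (u d))))) := by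
    have h2 : halves₂ D D' a b (homog (u d)) = (∑ m ∈ Finset.range (d + 1),
        ∑ m' ∈ Finset.range (d + 1), coeffAt D.create (a + m) * coeffAt D'.create (b + m') *
          D.annih m * D'.annih m') (homog (u d)) := DirectSum.toModule_lof _ _ _
    rw [h2, LinearMap.sum_apply]
    have hs := Finset.range_subset_range.2 (show d + 1 ≤ N from hd)
    rw [← Finset.sum_subset hs]
    · refine Finset.sum_congr rfl fun m _ => ?_
      rw [LinearMap.sum_apply]
      refine Finset.sum_subset hs fun m' _ hm' => ?_
      rw [Finset.mem_range] at hm'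
      rw [Module.End.mul_apply, (degLT_homog (u d)).annih_eq_zero hA' (by omega), map_zero]
    · intro m _ hm
      rw [Finset.mem_range] at hm
      refine Finset.sum_eq_zero fun m' _ => ?_
      rw [((degLT_homog (u d)).annih hA' m').annih_eq_zero hA (by omega), map_zero, map_zero]
  conv_lhs => rw [hu.eq_sum, map_sum]
  rw [Finset.sum_congr rfl fun d hd => h1 d (Finset.mem_range.1 hd), Finset.sum_comm]
  refine Finset.sum_congr rfl fun m _ => ?_
  rw [Finset.sum_comm]
  refine Finset.sum_congr rfl fun m' _ => ?_
  conv_rhs => rw [hu.eq_sum, map_sum, map_sum, map_sum, map_sum]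

theorem halves₂_lt {D D' : VertexData r Γ} {φ φ' : Fam Γ}
    (hA : ∀ n u, fam (D.annih n u) = contr φ n (fam u))
    (hA' : ∀ n u, fam (D'.annih n u) = contr φ' n (fam u)) {N : ℕ} {u : RGr Γ} (hu : DegLT N u)
    (a b : ℤ) (hb : b < -N) : halves₂ D D' a b u = 0 := by
  rw [halves₂_eq hA hA' hu]
  refine Finset.sum_eq_zero fun m _ => Finset.sum_eq_zero fun m' hm' => ?_
  rw [Finset.mem_range] at hm'
  rw [coeffAt_of_neg D'.create (by omega), LinearMap.zero_apply, map_zero]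

/-- The operators `A n` and `C m` satisfy `A(z) C(w) = f(w/z) C(w) A(z)`. -/
def Contracts (f : PowerSeries K) (A C : ℕ → Module.End K (RGr Γ)) : Prop :=
  ∀ n m, A n * C m = ∑ a ∈ antidiagonal m, if a.1 ≤ n then
    PowerSeries.coeff a.1 f • (C a.2 * A (n - a.1)) else 0

-- The sum over splittings of the creation index is rewritten as one over splittings of the
-- annihilation index. Both are effectively indexed by k ≤ min(n, m): the condition cuts one, the
-- vanishing of `coeffAt` at negative indices the other.
omit [Fintype Γ] in
theorem Contracts.mul_coeffAt {f : PowerSeries K} {A C : ℕ → Module.End K (RGr Γ)}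
    (h : Contracts f A C) (n : ℕ) (b : ℤ) :
    A n * coeffAt C b = ∑ p ∈ antidiagonal n,
      PowerSeries.coeff p.1 f • (coeffAt C (b - p.1) * A p.2) := by
  rcases lt_or_ge b 0 with hb | hb
  · rw [coeffAt_of_neg C hb, mul_zero]
    refine (Finset.sum_eq_zero fun p _ => ?_).symm
    rw [coeffAt_of_neg C (by omega), zero_mul, smul_zero]
  · obtain ⟨m, rfl⟩ := Int.eq_ofNat_of_zero_le hb
    rw [coeffAt_natCast, h, Finset.Nat.sum_antidiagonal_eq_sum_range_succ
      (fun k l => if k ≤ n then PowerSeries.coeff k f • (C l * A (n - k)) else 0),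
      Finset.Nat.sum_antidiagonal_eq_sum_range_succ
      (fun k l => PowerSeries.coeff k f • (coeffAt C (m - k) * A l))]
    have h1 : ∀ k ∈ Finset.range (m + n + 1), k ∉ Finset.range n.succ →
        (if k ≤ n ∧ k ≤ m then PowerSeries.coeff k f • (C (m - k) * A (n - k)) else 0) = 0 := by
      intro k _ hk
      rw [Finset.mem_range] at hk
      exact if_neg (by omega)
    have h2 : ∀ k ∈ Finset.range (m + n + 1), k ∉ Finset.range m.succ →
        (if k ≤ n ∧ k ≤ m then PowerSeries.coeff k f • (C (m - k) * A (n - k)) else 0) = 0 := by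
      intro k _ hk
      rw [Finset.mem_range] at hk
      exact if_neg (by omega)
    have e1 := Finset.sum_subset (Finset.range_subset_range.2 (by omega)) h1
    have e2 := Finset.sum_subset (Finset.range_subset_range.2 (by omega)) h2
    refine Eq.trans ?_ ((e2.trans e1.symm).trans ?_)
    · refine Finset.sum_congr rfl fun k hk => ?_
      rw [Finset.mem_range] at hk
      have : k ≤ m := by omega
      simp [this]
    · refine Finset.sum_congr rfl fun k hk => ?_
      rw [Finset.mem_range] at hk
      by_cases hkm : k ≤ m
      · rw [if_pos (by omega), ← coeffAt_natCast C, Nat.cast_sub hkm]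
      · rw [if_neg (by omega), coeffAt_of_neg C (by omega), zero_mul, smul_zero]

/-- Coefficientwise form of moving A(z) past C'(w): each annihilation index m splits as k + l, where
k is the power of w/z taken from `f` and l is the index of the operator that remains. -/
theorem halves_halves {D D' : VertexData r Γ} {φ φ' : Fam Γ} {f : PowerSeries K}
    (hA : ∀ n u, fam (D.annih n u) = contr φ n (fam u))
    (hA' : ∀ n u, fam (D'.annih n u) = contr φ' n (fam u))
    (hf : Contracts f D.annih D'.create) (u : RGr Γ) (a b : ℤ) :
    halves D a (halves D' b u) = seriesMul f (fun a b => halves₂ D D' a b u) a b := by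
  obtain ⟨N, hu⟩ := exists_degLT u
  have hex (m' : ℕ) := exists_degLT (coeffAt D'.create (b + m') (D'.annih m' u))
  choose L hL using hex
  -- Large enough to bound the degrees of the intermediate vectors, and such that k + l ≥ M forces
  -- either l ≥ N, where annihilation gives zero, or k > b + N, where the creation index is
  -- negative.
  let M : ℕ := N + ((b + N).toNat + 1) + ∑ m' ∈ Finset.range N, L m'
  have hM : N + ((b + N).toNat + 1) ≤ M := Nat.le_add_right _ _
  rw [seriesMul_eq_sum (N := M) (X := fun a b => halves₂ D D' a b u) f
    (halves₂_lt hA hA' hu) (by omega), halves_eq hA' hu, map_sum]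
  have h1 (m' : ℕ) (hm' : m' < N) :
      halves D a (coeffAt D'.create (b + m') (D'.annih m' u)) =
        ∑ k ∈ Finset.range M, ∑ l ∈ Finset.range N, PowerSeries.coeff k f •
          coeffAt D.create (a + k + l)
            (coeffAt D'.create (b - k + m') (D.annih l (D'.annih m' u))) := by
    have hLM : L m' ≤ M := (Finset.single_le_sum (f := L) (fun _ _ => Nat.zero_le _)
      (Finset.mem_range.2 hm')).trans (Nat.le_add_left _ _)
    have h2 : ∀ k, ∑ l ∈ Finset.range N, PowerSeries.coeff k f • coeffAt D.create (a + k + l)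
        (coeffAt D'.create (b - k + m') (D.annih l (D'.annih m' u))) =
        ∑ l ∈ Finset.range M, PowerSeries.coeff k f • coeffAt D.create (a + k + l)
        (coeffAt D'.create (b - k + m') (D.annih l (D'.annih m' u))) := by
      intro k
      refine Finset.sum_subset (Finset.range_subset_range.2 (by omega)) fun l _ hl => ?_
      rw [Finset.mem_range] at hl
      rw [(hu.annih hA' m').annih_eq_zero hA (by omega), map_zero, map_zero, smul_zero]
    simp only [h2]
    rw [halves_eq hA ((hL m').mono hLM), ← sum_antidiagonal_eq_sum_square M fun k l =>
      PowerSeries.coeff k f • coeffAt D.create (a + k + l)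
        (coeffAt D'.create (b - k + m') (D.annih l (D'.annih m' u)))]
    · refine Finset.sum_congr rfl fun m _ => ?_
      rw [← Module.End.mul_apply (D.annih m), hf.mul_coeffAt, LinearMap.sum_apply, map_sum]
      refine Finset.sum_congr rfl fun p hp => ?_
      rw [Finset.HasAntidiagonal.mem_antidiagonal] at hp
      rw [LinearMap.smul_apply, map_smul, Module.End.mul_apply, ← hp, sub_add_eq_add_sub,
        Nat.cast_add, add_assoc]
    · intro k l hkl
      by_cases hl : N ≤ l
      · rw [(hu.annih hA' m').annih_eq_zero hA hl, map_zero, map_zero, smul_zero]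
      · rw [coeffAt_of_neg D'.create (by omega), LinearMap.zero_apply, map_zero, smul_zero]
  rw [Finset.sum_congr rfl fun m' hm' => h1 m' (Finset.mem_range.1 hm'), Finset.sum_comm]
  refine Finset.sum_congr rfl fun k _ => ?_
  rw [Finset.sum_comm, halves₂_eq hA hA' hu, Finset.smul_sum]
  simp only [Finset.smul_sum]

omit [Fintype Γ] in
theorem vertexOp_single (ε : RLat r → RLat r → ℂˣ) (D : VertexData r Γ) (a : ℤ) (β : RLat r)
    (u : RGr Γ) : vertexOp ε D a (Finsupp.single β u) =
      (LaurentPolynomial.C ((ε D.charge β : ℂˣ) : ℂ) * D.scal β : K) •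
        Finsupp.single (D.charge + β) (halves D (a - D.expo β) u) := by
  rw [vertexOp, Finsupp.lsum_single]
  rfl

omit [Fintype Γ] in
theorem normalProd_single (ε : RLat r → RLat r → ℂˣ) (D D' : VertexData r Γ) (a b : ℤ)
    (β : RLat r) (u : RGr Γ) : normalProd ε D D' a b (Finsupp.single β u) =
      (LaurentPolynomial.C ((ε (D.charge + D'.charge) β : ℂˣ) : ℂ) * D.scal β * D'.scal β : K) •
        Finsupp.single (D.charge + D'.charge + β)
          (halves₂ D D' (a - D.expo β) (b - D'.expo β) u) := by
  rw [normalProd, Finsupp.lsum_single]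
  rfl

/-- The operator product expansion of two vertex operators whose halves have contraction `f`. -/
theorem vertexOp_vertexOp {ε : RLat r → RLat r → ℂˣ} (hε : IsTwistingCocycle ε)
    {D D' : VertexData r Γ} {φ φ' : Fam Γ} {f : PowerSeries K}
    (hA : ∀ n u, fam (D.annih n u) = contr φ n (fam u))
    (hA' : ∀ n u, fam (D'.annih n u) = contr φ' n (fam u))
    (hf : Contracts f D.annih D'.create) {e : ℤ} {κ : K}
    (he : ∀ β, D.expo (D'.charge + β) = e + D.expo β)
    (hκ : ∀ β, D.scal (D'.charge + β) = κ * D.scal β) (v : Fock r Γ) :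
    BoundedBelow (fun a b => normalProd ε D D' a b v) ∧
    ∀ a b : ℤ, vertexOp ε D a (vertexOp ε D' b v) =
      (LaurentPolynomial.C ((ε D.charge D'.charge : ℂˣ) : ℂ) : K) • κ •
        seriesMul f (fun a b => normalProd ε D D' a b v) (a - e) b := by
  induction v using Finsupp.induction_linear with
  | zero =>
    refine ⟨⟨0, fun a b _ => map_zero _⟩, fun a b => ?_⟩
    simp [seriesMul]
  | add v v' hv hv' =>
    obtain ⟨hb, h⟩ := hv
    obtain ⟨hb', h'⟩ := hv'
    simp only [map_add]
    refine ⟨?_, fun a b => ?_⟩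
    · obtain ⟨B, hB⟩ := hb
      obtain ⟨B', hB'⟩ := hb'
      refine ⟨min B B', fun a b hlt => ?_⟩
      beta_reduce at hB hB' ⊢
      rw [hB _ _ (lt_of_lt_of_le hlt (min_le_left _ _)),
        hB' _ _ (lt_of_lt_of_le hlt (min_le_right _ _)), add_zero]
    · rw [h, h', seriesMul_add f hb hb', smul_add, smul_add]
  | single β u =>
    obtain ⟨N, hu⟩ := exists_degLT u
    have hb' : BoundedBelow fun a b => halves₂ D D' (a - D.expo β) (b - D'.expo β) u :=
      ⟨D'.expo β - N, fun a b h => halves₂_lt hA hA' hu _ _ (by omega)⟩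
    constructor
    · obtain ⟨B, hB⟩ := hb'
      refine ⟨B, fun a b h => ?_⟩
      beta_reduce at hB ⊢
      rw [normalProd_single, hB a b h, Finsupp.single_zero, smul_zero]
    · intro a b
      set c : K := LaurentPolynomial.C ((ε (D.charge + D'.charge) β : ℂˣ) : ℂ) * D.scal β *
        D'.scal β with hc
      set L : RGr Γ →ₗ[K] Fock r Γ :=
        c • (Finsupp.lsingle (D.charge + D'.charge + β) : RGr Γ →ₗ[K] Fock r Γ)
      have h1 : (fun a b => normalProd ε D D' a b (Finsupp.single β u)) = fun a b =>
          L (halves₂ D D' (a - D.expo β) (b - D'.expo β) u) :=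
        funext fun a => funext fun b => normalProd_single ε D D' a b β u
      have h2 : seriesMul f (fun a b => halves₂ D D' (a - D.expo β) (b - D'.expo β) u) (a - e) b =
          halves D (a - (e + D.expo β)) (halves D' (b - D'.expo β) u) := by
        rw [halves_halves hA hA' hf]
        unfold seriesMul
        refine finsum_congr fun n => ?_
        beta_reduce
        -- The shift by e is the power of z gained when the first lattice operator passes the second
        -- charge.
        rw [show a - e + n - D.expo β = a - (e + D.expo β) + n by ring,
          show b - (n : ℤ) - D'.expo β = b - D'.expo β - n by ring]
      have h3 : seriesMul f (fun a b => normalProd ε D D' a b (Finsupp.single β u)) (a - e) b =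
          c • Finsupp.single (D.charge + D'.charge + β)
            (halves D (a - (e + D.expo β)) (halves D' (b - D'.expo β) u)) := by
        rw [h1, ← h2]
        exact seriesMul_map f hb' L (a - e) b
      rw [h3, vertexOp_single, map_smul, vertexOp_single, he, hκ, add_assoc, smul_smul, smul_smul,
        smul_smul]
      congr 1
      -- Associativity of the twisted group algebra: it trades the two successive factors of ε for
      -- the one in the normal ordered product times the prefactor.
      have h4 := congrArg (fun t : ℂˣ => LaurentPolynomial.C ((t : ℂˣ) : ℂ))
        (hε.cocycle D.charge D'.charge β)
      simp only [Units.val_mul, map_mul] at h4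
      rw [hc]
      linear_combination (-κ * D.scal β * D'.scal β) * h4

end VertexOperators

/-! ### The weight ξ and the contraction series of the vertex operators -/

section Main

variable {r : ℕ} {Γ : Type*} [Group Γ]
variable (γ : Multiplicative (ZMod (r + 1)) ≃* (Γ →* ℂˣ))

theorem chr_add (i j : ZMod (r + 1)) : chr γ (i + j) = chr γ i * chr γ j := by
  rw [chr, ofAdd_add, map_mul]; rfl

theorem chr_eq_one_iff (i : ZMod (r + 1)) : chr γ i = 1 ↔ i = 0 := by
  rw [chr, map_eq_one_iff γ γ.injective]; rfl

theorem natCast_eq_neg_one : (r : ZMod (r + 1)) = -1 := by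
  have : ((r + 1 : ℕ) : ZMod (r + 1)) = 0 := ZMod.natCast_self _
  push_cast at this
  exact eq_neg_of_add_eq_zero_left this

theorem qPow_add (m n : ℤ) : qPow (m + n) = qPow m * qPow n := by
  rw [qPow, mul_add, LaurentPolynomial.T_add]; rfl

theorem qPow_zero : qPow 0 = 1 := by
  rw [qPow, mul_zero, LaurentPolynomial.T_zero]

theorem pmul_lin_one (χ : Γ →* ℂˣ) (δ δ' : ℕ) (c c' : K) :
    pmul (lin 1 δ c) (lin χ δ' c') = lin χ (δ + δ') (c * c') := by
  rw [pmul_lin]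
  congr 1
  ext x
  simp

theorem tens_xi_pos (s : ℤ) : tens (xi γ s).pos =
    conv (lin (chr γ 0) 0 (qPow (-1))) (lin (chr γ 0) 0 (qPow 1)) := tens_two _ _ _ _

theorem tens_xi_neg (s : ℤ) : tens (xi γ s).neg =
    conv (lin (chr γ (r : ZMod (r + 1))) 0 (qPow (-s))) (lin (chr γ 1) 0 (qPow s)) :=
  tens_two _ _ _ _

/-- Each of the four one-dimensional constituents of ξ contributes one linear character; the
subtracted ones carry a sign character and a minus sign on their scalar. -/
theorem etaFam_xi (s : ℤ) : etaFam (xi γ s) =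
    conv (conv (lin (chr γ 0) 0 (qPow (-1))) (lin (chr γ 0) 0 (qPow 1)))
      (conv (lin (chr γ (-1)) 1 (-qPow (-s))) (lin (chr γ 1) 1 (-qPow s))) := by
  rw [etaFam, tens_xi_pos, tens_xi_neg, pmul_conv (lin_groupLike _ _ _) (lin_invariant _ _ _),
    pmul_lin_one, pmul_lin_one, natCast_eq_neg_one, neg_one_mul, neg_one_mul]

theorem etaFam_xi_groupLike (s : ℤ) : GroupLike (etaFam (xi γ s)) := by
  rw [etaFam_xi]
  exact ((lin_groupLike _ _ _).conv (lin_groupLike _ _ _) (lin_invariant _ _ _)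
    (lin_invariant _ _ _)).conv ((lin_groupLike _ _ _).conv (lin_groupLike _ _ _)
    (lin_invariant _ _ _) (lin_invariant _ _ _)) ((lin_invariant _ _ _).conv (lin_invariant _ _ _))
    ((lin_invariant _ _ _).conv (lin_invariant _ _ _))

theorem etaFam_pos (i : ZMod (r + 1)) (l : ℤ) :
    etaFam ((PM.pos i).rep γ l) = lin (chr γ i) 0 (qPow l) := by
  change conv (tens (TRep.single (chr γ i) l)) (pmul _ (tens TRep.zero)) = _
  rw [tens_zero, pmul_lin_unitFam, tens_single, conv_unitFam (lin_invariant _ _ _)]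

theorem etaFam_neg (i : ZMod (r + 1)) (l : ℤ) :
    etaFam ((PM.neg i).rep γ l) = lin (chr γ i) 1 (-qPow l) := by
  change conv (tens TRep.zero) (pmul _ (tens (TRep.single (chr γ i) l))) = _
  rw [tens_zero, tens_single, pmul_lin_one, neg_one_mul, unitFam_conv (lin_invariant _ _ _)]

theorem smul_trunc_lin (χ : Γ →* ℂˣ) (δ n : ℕ) (c : K) :
    (-1 : K) ^ n • trunc n (lin χ δ c) = trunc n (lin χ δ (-c)) := by
  classical
  funext α _ x
  simp only [Pi.smul_apply, trunc, smul_eq_mul]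
  split_ifs with h
  · rw [lin_eq, lin_eq, h, neg_pow c]
    ring
  · rw [mul_zero]

variable [Fintype Γ]

/-- The operators `A n` contract with `η_n(ξ)` times a linear character. -/
def AnnihBy (s : ℤ) (i : ZMod (r + 1)) (δ : ℕ) (c : K) (A : ℕ → Module.End K (RGr Γ)) : Prop :=
  ∀ n u, fam (A n u) = contr (finv (pmul (etaFam (xi γ s)) (lin (chr γ i) δ c))) n (fam u)

/-- The operators `C n` multiply by a linear character. -/
def CreateBy (i : ZMod (r + 1)) (δ : ℕ) (c : K) (C : ℕ → Module.End K (RGr Γ)) : Prop :=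
  ∀ n u, fam (C n u) = conv (trunc n (lin (chr γ i) δ c)) (fam u)

variable {γ}

theorem createBy_Hneg {X : VRep Γ} {i : ZMod (r + 1)} {δ : ℕ} {c : K}
    (h : etaFam X = lin (chr γ i) δ c) : CreateBy γ i δ c (Hneg X) := by
  intro n u
  rw [Hneg, fam_creation, fam_homog_eq_trunc _ (lin_invariant _ _ _)]
  intro x
  rw [eta_eq, h]

theorem createBy_Eneg {X : VRep Γ} {i : ZMod (r + 1)} {δ : ℕ} {c : K}
    (h : etaFam X = lin (chr γ i) δ c) : CreateBy γ i (1 + δ) c (Eneg X) := by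
  intro n u
  rw [Eneg, fam_creation, fam_homog_eq_trunc _ (lin_invariant _ _ _)]
  intro x
  rw [eps_eq, h, pmul_lin_one, one_mul]

omit [Fintype Γ] in
theorem CreateBy.neg {i : ZMod (r + 1)} {δ : ℕ} {c : K} {C : ℕ → Module.End K (RGr Γ)}
    (h : CreateBy γ i δ c C) : CreateBy γ i δ (-c) fun n => (-1 : K) ^ n • C n := by
  intro n u
  rw [← smul_trunc_lin, LinearMap.smul_apply]
  funext α _ x
  rw [fam_smul, h]
  simp only [conv, Pi.smul_apply, smul_eq_mul]
  rw [Finset.mul_sum]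
  refine Finset.sum_congr rfl fun p _ => ?_
  split_ifs
  · rw [mul_assoc]
  · rw [mul_zero]

theorem annihBy_Hpos {s : ℤ} {X : VRep Γ} {i : ZMod (r + 1)} {δ : ℕ} {c : K}
    (h : etaFam X = lin (chr γ i) δ c) : AnnihBy γ s i δ c (Hpos γ s X) := by
  intro n u
  refine fam_annihilation _ _ (fun x => ?_) u
  rw [eta_eq, eta_eq, h]
  rfl

theorem annihBy_Epos {s : ℤ} {X : VRep Γ} {i : ZMod (r + 1)} {δ : ℕ} {c : K}
    (h : etaFam X = lin (chr γ i) δ c) : AnnihBy γ s i (1 + δ) c (Epos γ s X) := by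
  intro n u
  refine fam_annihilation _ _ (fun x => ?_) u
  rw [eta_eq, eps_eq, h, pmul_lin_one, one_mul]
  rfl

theorem AnnihBy.neg {s : ℤ} {i : ZMod (r + 1)} {δ : ℕ} {c : K} {A : ℕ → Module.End K (RGr Γ)}
    (h : AnnihBy γ s i δ c A) : AnnihBy γ s i δ (-c) fun n => (-1 : K) ^ n • A n := by
  intro n u
  rw [LinearMap.smul_apply]
  funext α _ y
  rw [fam_smul, h, contr, contr, ← avg_smul]
  congr 1
  funext x
  simp only [finv, pmul]
  rw [lin_eq, lin_eq, Fintype.card_fin, neg_pow c]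
  ring

/-- Averages are invariant under x ↦ x⁻¹. Moving the inversion onto the creation character avoids
having to invert η(ξ). -/
theorem avg_pmul_finv (φ ψ : Fam Γ) (n : ℕ) :
    avg (pmul (finv φ) ψ (Fin n)) = avg (pmul φ (finv ψ) (Fin n)) := by
  have h : pmul (finv φ) ψ (Fin n) = fun x => pmul φ (finv ψ) (Fin n) x⁻¹ := by
    funext x
    rw [pmul, pmul, finv, finv, inv_inv]
  rw [h, avg_inv]

variable (γ) in
/-- The generating series of the pairings of `η_n(ξ)` times a linear character with a linear
character. -/
def contractionSeries (s : ℤ) (d : ZMod (r + 1)) (δ : ℕ) (c : K) : PowerSeries K :=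
  avgSeries (lin (chr γ d) δ (c * qPow (-1))) * avgSeries (lin (chr γ d) δ (c * qPow 1)) *
    (avgSeries (lin (chr γ (d + -1)) (δ + 1) (c * -qPow (-s))) *
      avgSeries (lin (chr γ (d + 1)) (δ + 1) (c * -qPow s)))

omit [Fintype Γ] in
theorem pmul_lin_etaFam_xi (s : ℤ) (d : ZMod (r + 1)) (δ : ℕ) (c : K) :
    pmul (lin (chr γ d) δ c) (etaFam (xi γ s)) =
      conv (conv (lin (chr γ d) δ (c * qPow (-1))) (lin (chr γ d) δ (c * qPow 1)))
        (conv (lin (chr γ (d + -1)) (δ + 1) (c * -qPow (-s)))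
          (lin (chr γ (d + 1)) (δ + 1) (c * -qPow s))) := by
  rw [etaFam_xi, pmul_conv (lin_groupLike _ _ _) (lin_invariant _ _ _),
    pmul_conv (lin_groupLike _ _ _) (lin_invariant _ _ _),
    pmul_conv (lin_groupLike _ _ _) (lin_invariant _ _ _)]
  simp only [pmul_lin, ← chr_add, add_zero]

theorem avgSeries_pmul_lin_etaFam_xi (s : ℤ) (d : ZMod (r + 1)) (δ : ℕ) (c : K) :
    avgSeries (pmul (lin (chr γ d) δ c) (etaFam (xi γ s))) = contractionSeries γ s d δ c := by
  rw [pmul_lin_etaFam_xi, avgSeries_conv ((lin_invariant _ _ _).conv (lin_invariant _ _ _))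
    ((lin_invariant _ _ _).conv (lin_invariant _ _ _)),
    avgSeries_conv (lin_invariant _ _ _) (lin_invariant _ _ _),
    avgSeries_conv (lin_invariant _ _ _) (lin_invariant _ _ _)]
  rfl

-- Only the difference i - j of the characters, the total sign exponent and the product of the
-- scalars enter a contraction.
omit [Fintype Γ] in
theorem pmul_pmul_finv_lin (F : Fam Γ) (i j : ZMod (r + 1)) (δ δ' : ℕ) (c c' : K) :
    pmul (pmul F (lin (chr γ i) δ c)) (finv (lin (chr γ j) δ' c')) =
      pmul (lin (chr γ (i - j)) (δ + δ') (c * c')) F := by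
  have h2 : chr γ (i - j) = chr γ i * (chr γ j)⁻¹ := by
    ext x
    have h := DFunLike.congr_fun (chr_add γ (i - j) j) x
    rw [sub_add_cancel, MonoidHom.mul_apply] at h
    rw [MonoidHom.mul_apply, MonoidHom.inv_apply, h, mul_inv_cancel_right]
  rw [h2, ← pmul_lin, ← finv_lin]
  funext α _ x
  simp only [pmul]
  ring

/-- The contraction series of an annihilation part and a creation part. -/
theorem AnnihBy.contracts {s : ℤ} {i j : ZMod (r + 1)} {δ δ' : ℕ} {c c' : K}
    {A C : ℕ → Module.End K (RGr Γ)} (hA : AnnihBy γ s i δ c A) (hC : CreateBy γ j δ' c' C) :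
    Contracts (contractionSeries γ s (i - j) (δ + δ') (c * c')) A C := by
  have hφ := (etaFam_xi_groupLike γ s).pmul (lin_groupLike (chr γ i) δ c)
  have hφ' := (etaFam_invariant (xi γ s)).pmul (lin_invariant (chr γ i) δ c)
  intro n m
  rw [annih_mul_create hφ.finv hφ'.finv (lin_groupLike (chr γ j) δ' c')
    (lin_invariant (chr γ j) δ' c') hA hC n m]
  refine Finset.sum_congr rfl fun a _ => ?_
  rw [avg_pmul_finv, pmul_pmul_finv_lin, ← avgSeries_pmul_lin_etaFam_xi, avgSeries,
    PowerSeries.coeff_mk]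

theorem pair_smul_single_add (i j : ZMod (r + 1)) (σ : ℤ) (β : RLat r) :
    pair i (σ • Pi.single j 1 + β) = σ * cartan i j + pair i β := by
  unfold pair
  simp only [Pi.add_apply, Pi.smul_apply, smul_eq_mul, add_mul, Finset.sum_add_distrib]
  rw [Finset.sum_eq_single j]
  · simp
  · intro l _ hl
    simp [hl]
  · simp

theorem pairB_smul_single_add (i j : ZMod (r + 1)) (σ : ℤ) (β : RLat r) :
    pairB i (σ • Pi.single j 1 + β) = σ * (cartan i j * bMat i j) + pairB i β := by
  unfold pairB
  simp only [Pi.add_apply, Pi.smul_apply, smul_eq_mul, add_mul, Finset.sum_add_distrib]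
  rw [Finset.sum_eq_single j]
  · simp [mul_assoc]
  · intro l _ hl
    simp [hl]
  · simp

theorem pHalfPow_add (s m n : ℤ) : pHalfPow s (m + n) = pHalfPow s m * pHalfPow s n := by
  rw [pHalfPow, mul_add, LaurentPolynomial.T_add]; rfl

variable (γ) in
/-- A vertex operator whose creation part, annihilation part and charge are attached to `±γ_i`,
with sign `σ` in the exponents. -/
structure IsVertex (s : ℤ) (i : ZMod (r + 1)) (σ : ℤ) (δA : ℕ) (cA : K) (δC : ℕ) (cC : K)
    (D : VertexData r Γ) : Prop where
  annih : AnnihBy γ s i δA cA D.annih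
  create : CreateBy γ i δC cC D.create
  charge : D.charge = σ • Pi.single i 1
  expo : ∀ β, D.expo β = σ * pair i β
  scal : ∀ β, D.scal β = pHalfPow s (-(σ * pairB i β))

section OPE

variable {ε : RLat r → RLat r → ℂˣ} (hε : IsTwistingCocycle ε) {s : ℤ} {i j : ZMod (r + 1)}
  {σ σ' : ℤ} {δA δC δA' δC' : ℕ} {cA cC cA' cC' : K} {D D' : VertexData r Γ}
  (hD : IsVertex γ s i σ δA cA δC cC D) (hD' : IsVertex γ s j σ' δA' cA' δC' cC' D')

-- The uniform expansion behind all eight identities: the shift of z and the power of p come from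
-- the lattice part, the power series from the commutation of the halves. What remains is to
-- identify the series case by case.
include hε hD hD' in
theorem IsVertex.ope : OPE ε D D' fun X a b =>
    pHalfPow s (-(σ * σ' * (cartan i j * bMat i j))) •
      seriesMul (contractionSeries γ s (i - j) (δA + δC') (cA * cC')) X
        (a - σ * σ' * cartan i j) b := by
  refine vertexOp_vertexOp hε hD.annih hD'.annih (hD.annih.contracts hD'.create) ?_ ?_
  · intro β
    rw [hD.expo, hD.expo, hD'.charge, pair_smul_single_add]
    ring
  · intro β
    rw [hD.scal, hD.scal, hD'.charge, pairB_smul_single_add, ← pHalfPow_add]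
    congr 1
    ring

end OPE

end Main

/-! ### Identification of the rational factors and of the eight pairs of operators -/

section Factors

variable {r : ℕ} {Γ : Type*} [Group Γ] [Fintype Γ]
variable (γ : Multiplicative (ZMod (r + 1)) ≃* (Γ →* ℂˣ))

theorem one_ne_zero_zmod (hr : 1 ≤ r) : (1 : ZMod (r + 1)) ≠ 0 := by
  have : Fact (1 < r + 1) := ⟨by omega⟩
  exact one_ne_zero

theorem eq_of_cartan_eq_two {i j : ZMod (r + 1)} (h : cartan i j = 2) : i = j := by
  by_contra hij
  rw [cartan, if_neg hij] at h
  split_ifs at h <;> omega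

theorem ne_of_cartan_eq_zero (hr : 1 ≤ r) {i j : ZMod (r + 1)} (h : cartan i j = 0) :
    i ≠ j ∧ i + 1 ≠ j ∧ i - 1 ≠ j := by
  have h1 := one_ne_zero_zmod hr
  have hij : i ≠ j := by
    rintro rfl
    rw [cartan, if_pos rfl, if_neg (by simpa using h1), if_neg (by simpa using h1)] at h
    omega
  rw [cartan, if_neg hij] at h
  refine ⟨hij, fun h2 => ?_, fun h2 => ?_⟩
  · rw [if_pos h2] at h
    split_ifs at h <;> omega
  · rw [if_pos h2] at h
    split_ifs at h <;> omega

/-- If both neighbours of i coincide with j ≠ i, as happens for r = 1, the entry is -2; so -1 forces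
exactly one of the two equalities. -/
theorem ne_of_cartan_eq_neg_one (hr : 1 ≤ r) {i j : ZMod (r + 1)} (h : cartan i j = -1) :
    i ≠ j ∧ ((i + 1 = j ∧ i - 1 ≠ j) ∨ (i + 1 ≠ j ∧ i - 1 = j)) := by
  have h1 := one_ne_zero_zmod hr
  have hij : i ≠ j := by
    rintro rfl
    rw [cartan, if_pos rfl, if_neg (by simpa using h1), if_neg (by simpa using h1)] at h
    omega
  refine ⟨hij, ?_⟩
  rw [cartan, if_neg hij] at h
  by_cases h2 : i + 1 = j
  · refine Or.inl ⟨h2, fun h3 => ?_⟩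
    rw [if_pos h2, if_pos h3] at h
    omega
  · refine Or.inr ⟨h2, ?_⟩
    by_contra h3
    rw [if_neg h2, if_neg h3] at h
    omega

variable {γ}

theorem avgSeries_chr_of_ne {d : ZMod (r + 1)} (hd : d ≠ 0) (δ : ℕ) (c : K) :
    avgSeries (lin (chr γ d) δ c) = 1 :=
  avgSeries_lin_of_ne (fun h => hd ((chr_eq_one_iff γ d).1 h)) δ c

theorem avgSeries_chr_even {d : ZMod (r + 1)} (hd : d = 0) {δ : ℕ} (hδ : Even δ) (c : K) :
    avgSeries (lin (chr γ d) δ c) = PowerSeries.mk fun n => c ^ n := by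
  rw [(chr_eq_one_iff γ d).2 hd, avgSeries_lin_even hδ]

theorem avgSeries_chr_odd {d : ZMod (r + 1)} (hd : d = 0) {δ : ℕ} (hδ : Odd δ) (c : K) :
    avgSeries (lin (chr γ d) δ (-c)) = 1 - PowerSeries.C c * PowerSeries.X := by
  rw [(chr_eq_one_iff γ d).2 hd, avgSeries_lin_odd hδ, map_neg, neg_mul, sub_eq_add_neg]

theorem contractionSeries_of_cartan_zero (hr : 1 ≤ r) (s : ℤ) {i j : ZMod (r + 1)}
    (h : cartan i j = 0) (δ : ℕ) (c : K) : contractionSeries γ s (i - j) δ c = 1 := by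
  obtain ⟨h0, h1, h2⟩ := ne_of_cartan_eq_zero hr h
  rw [contractionSeries, avgSeries_chr_of_ne (sub_ne_zero.2 h0),
    avgSeries_chr_of_ne (sub_ne_zero.2 h0),
    avgSeries_chr_of_ne (by rw [← sub_ne_zero] at h2; convert h2 using 1; ring),
    avgSeries_chr_of_ne (by rw [← sub_ne_zero] at h1; convert h1 using 1; ring)]
  simp

theorem contractionSeries_of_cartan_two (hr : 1 ≤ r) (s : ℤ) {i j : ZMod (r + 1)}
    (h : cartan i j = 2) (δ : ℕ) (c : K) : contractionSeries γ s (i - j) δ c =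
      avgSeries (lin (chr γ (i - j)) δ (c * qPow (-1))) *
        avgSeries (lin (chr γ (i - j)) δ (c * qPow 1)) := by
  obtain rfl := eq_of_cartan_eq_two h
  have h1 := one_ne_zero_zmod hr
  rw [contractionSeries, avgSeries_chr_of_ne (d := i - i + -1) (by simpa using h1),
    avgSeries_chr_of_ne (d := i - i + 1) (by simpa using h1)]
  simp

/-- Exactly one of γ_{d-1}, γ_{d+1} is trivial, with d = i - j. The sign of b_{ij} records which,
and with it whether p⁻¹ or p occurs. -/
theorem contractionSeries_of_cartan_neg_one (hr : 1 ≤ r) (s : ℤ) {i j : ZMod (r + 1)}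
    (h : cartan i j = -1) (δ : ℕ) (c : K) : contractionSeries γ s (i - j) δ c =
      avgSeries (lin (chr γ 0) (δ + 1) (c * -qPow (s * bMat i j))) := by
  obtain ⟨h0, h1⟩ := ne_of_cartan_eq_neg_one hr h
  rw [contractionSeries, avgSeries_chr_of_ne (sub_ne_zero.2 h0),
    avgSeries_chr_of_ne (sub_ne_zero.2 h0)]
  rcases h1 with ⟨h1, h2⟩ | ⟨h1, h2⟩
  · rw [avgSeries_chr_of_ne (d := i - j + -1)
      (by rw [← sub_ne_zero] at h2; convert h2 using 1; ring),
      show i - j + 1 = 0 by rw [← h1]; ring, bMat, if_pos h1, if_neg h2]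
    simp
  · rw [avgSeries_chr_of_ne (d := i - j + 1)
      (by rw [← sub_ne_zero] at h1; convert h1 using 1; ring),
      show i - j + -1 = 0 by rw [← h2]; ring, bMat, if_neg h1, if_pos h2]
    simp

theorem OPE.congr {ε : RLat r → RLat r → ℂˣ} {D D' : VertexData r Γ}
    {F F' : (ℤ → ℤ → Fock r Γ) → (ℤ → ℤ → Fock r Γ)} (h : OPE ε D D' F)
    (hF : ∀ X, BoundedBelow X → ∀ a b, F X a b = F' X a b) : OPE ε D D' F' := by
  intro v
  obtain ⟨hb, h⟩ := h v
  exact ⟨hb, fun a b => by rw [h, hF _ hb]⟩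

theorem qPow_neg_one_mul (m : ℤ) : qPow m * qPow (-1) = qPow (m - 1) := by
  rw [← qPow_add, sub_eq_add_neg]

section

variable {ε : RLat r → RLat r → ℂˣ} (hε : IsTwistingCocycle ε) (hr : 1 ≤ r) {s : ℤ}
  {i j : ZMod (r + 1)} {σ σ' : ℤ} {δA δC δA' δC' : ℕ} {cA cC cA' cC' : K}
  {D D' : VertexData r Γ}
  (hD : IsVertex γ s i σ δA cA δC cC D) (hD' : IsVertex γ s j σ' δA' cA' δC' cC' D')

include hε hr hD hD'

/-- An odd sign exponent makes the two q-factors linear, and the p-factor, whose exponent is one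
higher, geometric: a double zero for value 2 and a pole for value -1. The lattice shift of z by the
form completes w/z to the linear factors in z and w. -/
theorem IsVertex.sameCharge (hσ : σ * σ' = 1) (hδ : Odd (δA + δC')) {m : ℤ}
    (hc : cA * cC' = -qPow m) : SameCharge s ε D D' i j m := by
  refine ⟨fun h => ?_, fun h => ?_, fun h => ?_⟩ <;>
    refine (hD.ope hε hD').congr fun X hX a b => ?_
  · rw [contractionSeries_of_cartan_zero hr s h, seriesMul_one, h]
    simp [pHalfPow]
  · rw [contractionSeries_of_cartan_neg_one hr s h, hσ, h, hc,
      avgSeries_chr_even rfl hδ.add_one, Pi.smul_apply, Pi.smul_apply, divLin_eq_seriesMul]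
    simp [pPow]
  · rw [contractionSeries_of_cartan_two hr s h, hσ, hc, neg_mul, neg_mul,
      avgSeries_chr_odd (sub_eq_zero.2 (eq_of_cartan_eq_two h)) hδ,
      avgSeries_chr_odd (sub_eq_zero.2 (eq_of_cartan_eq_two h)) hδ,
      mulLin_mulLin_eq_seriesMul _ _ hX, qPow_neg_one_mul, ← qPow_add, h]
    obtain rfl := eq_of_cartan_eq_two h
    -- The diagonal of b vanishes, so the lattice part leaves no power of p.
    have hb : bMat i i = 0 := by
      rw [bMat, if_neg (by simpa using one_ne_zero_zmod hr),
        if_neg (by simpa using one_ne_zero_zmod hr), sub_zero]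
    simp [hb, pHalfPow]

/-- The parities are reversed with respect to equal charges, so zeros and poles exchange roles, and
the lattice shift changes sign accordingly. -/
theorem IsVertex.oppositeCharge (hσ : σ * σ' = -1) (hδ : Even (δA + δC')) {m : ℤ}
    (hc : cA * cC' = qPow m) : OppositeCharge s ε D D' i j m := by
  refine ⟨fun h => ?_, fun h => ?_, fun h => ?_⟩ <;>
    refine (hD.ope hε hD').congr fun X hX a b => ?_
  · rw [contractionSeries_of_cartan_zero hr s h, seriesMul_one, h]
    simp [pHalfPow]
  · rw [contractionSeries_of_cartan_neg_one hr s h, hσ, h, hc, mul_neg,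
      avgSeries_chr_odd rfl hδ.add_one, Pi.smul_apply, Pi.smul_apply, mulLin_eq_seriesMul]
    simp [pPow]
  · rw [contractionSeries_of_cartan_two hr s h, hσ, hc,
      avgSeries_chr_even (sub_eq_zero.2 (eq_of_cartan_eq_two h)) hδ,
      avgSeries_chr_even (sub_eq_zero.2 (eq_of_cartan_eq_two h)) hδ,
      divLin_divLin_eq_seriesMul _ _ hX, qPow_neg_one_mul, ← qPow_add, h]
    obtain rfl := eq_of_cartan_eq_two h
    have hb : bMat i i = 0 := by
      rw [bMat, if_neg (by simpa using one_ne_zero_zmod hr),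
        if_neg (by simpa using one_ne_zero_zmod hr), sub_zero]
    simp [hb, pHalfPow]

end

/-- The annihilation sign exponent 1 comes from ε_n, and its scalar -q^{-k} unites the weight q^{-k}
with the sign of (-z)^{-n}. -/
theorem isVertex_Yplus_pos (s : ℤ) (i : ZMod (r + 1)) (k : ℤ) :
    IsVertex γ s i 1 1 (-qPow (-k)) 0 1 (Yplus γ s (.pos i) k) where
  annih := (annihBy_Epos (etaFam_pos γ i (-k))).neg
  create := by
    have h := createBy_Hneg (etaFam_pos γ i 0)
    rw [qPow_zero] at h
    exact h
  charge := rfl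
  expo β := rfl
  scal β := rfl

/-- For -γ_i the family η already carries one sign character and one minus sign. The twist in ε_n
then gives exponent 2, of which only the parity matters, and the two minus signs cancel. -/
theorem isVertex_Yplus_neg (s : ℤ) (i : ZMod (r + 1)) (k : ℤ) :
    IsVertex γ s i (-1) 2 (qPow (-k)) 1 (-1) (Yplus γ s (.neg i) k) where
  annih := by
    have h := (annihBy_Epos (s := s) (etaFam_neg γ i (-k))).neg
    rw [neg_neg] at h
    exact h
  create := by
    have h := createBy_Hneg (etaFam_neg γ i 0)
    rw [qPow_zero] at h
    exact h
  charge := rfl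
  expo β := rfl
  scal β := rfl

theorem isVertex_Yminus_pos (s : ℤ) (i : ZMod (r + 1)) (k : ℤ) :
    IsVertex γ s i (-1) 0 1 1 (-qPow k) (Yminus γ s (.pos i) k) where
  annih := by
    have h := annihBy_Hpos (s := s) (etaFam_pos γ i 0)
    rw [qPow_zero] at h
    exact h
  create := (createBy_Eneg (etaFam_pos γ i k)).neg
  charge := (neg_smul _ _).symm
  expo β := (neg_mul _ _).symm
  scal β := by
    rw [neg_mul, neg_neg]
    rfl

theorem isVertex_Yminus_neg (s : ℤ) (i : ZMod (r + 1)) (k : ℤ) :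
    IsVertex γ s i 1 1 (-1) 2 (qPow k) (Yminus γ s (.neg i) k) where
  annih := by
    have h := annihBy_Hpos (s := s) (etaFam_neg γ i 0)
    rw [qPow_zero] at h
    exact h
  create := by
    have h := (createBy_Eneg (etaFam_neg γ i k)).neg
    rw [neg_neg] at h
    exact h
  charge := (neg_smul _ _).symm
  expo β := (neg_mul _ _).symm
  scal β := by
    change pHalfPow s (-1 * pairB i β) = _
    rw [neg_one_mul, one_mul]

omit [Fintype Γ] in
/-- A bimultiplicative form with values `±1` does not see the signs of `±γ_i`, `±γ_j`. -/
theorem bimultiplicative_eps_vec {ε : RLat r → RLat r → ℂˣ} (h1 : ∀ α β, ε α β = 1 ∨ ε α β = -1)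
    (hl : ∀ α α' β, ε (α + α') β = ε α β * ε α' β)
    (hr : ∀ α β β', ε α (β + β') = ε α β * ε α β') (g g' : PM r) :
    ε g.vec g'.vec = ε (PM.pos g.idx).vec (PM.pos g'.idx).vec := by
  have hsq (α β) : ε α β * ε α β = 1 := by
    rcases h1 α β with h | h <;> simp [h]
  -- Bimultiplicativity makes ε(-α, β) the inverse of ε(α, β), and values ±1 are their own inverses.
  have hnl (α β) : ε (-α) β = ε α β := by
    have h0 : ε 0 β = 1 := by
      have := hl 0 0 β
      rw [add_zero] at this
      exact this.trans (hsq 0 β)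
    have := hl (-α) α β
    rw [neg_add_cancel, h0, ← hsq α β] at this
    exact (mul_right_cancel this).symm
  have hnr (α β) : ε α (-β) = ε α β := by
    have h0 : ε α 0 = 1 := by
      have := hr α 0 0
      rw [add_zero] at this
      exact this.trans (hsq α 0)
    have := hr α (-β) β
    rw [neg_add_cancel, h0, ← hsq α β] at this
    exact (mul_right_cancel this).symm
  have hpos (l : ZMod (r + 1)) : (PM.pos l).vec = Pi.single l 1 := one_smul _ _
  have hneg (l : ZMod (r + 1)) : (PM.neg l).vec = -Pi.single l 1 := by
    rw [PM.vec, PM.sgn, neg_one_smul]; rfl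
  rcases g with l | l <;> rcases g' with l' | l' <;>
    simp only [PM.idx, hpos, hneg, hnl, hnr]

end Factors

end QVertex

end

theorem mainTheorem5 (r : ℕ) (hr : 1 ≤ r)
    (Γ : Type*) [Group Γ] [Fintype Γ] [IsCyclic Γ] (hΓ : Fintype.card Γ = r + 1)
    (γ : Multiplicative (ZMod (r + 1)) ≃* (Γ →* ℂˣ))
    (s : ℤ) (ε : RLat r → RLat r → ℂˣ) (hε : IsTwistingCocycle ε)
    (k : ℤ) (i j : ZMod (r + 1)) :
    SameCharge s ε (Yplus γ s (.pos i) k) (Yplus γ s (.pos j) k) i j (-k) ∧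
    SameCharge s ε (Yminus γ s (.pos i) k) (Yminus γ s (.pos j) k) i j k ∧
    OppositeCharge s ε (Yplus γ s (.pos i) k) (Yminus γ s (.pos j) k) i j 0 ∧
    OppositeCharge s ε (Yminus γ s (.pos i) k) (Yplus γ s (.pos j) k) i j 0 ∧
    OppositeCharge s ε (Yplus γ s (.pos i) k) (Yplus γ s (.neg j) (-k)) i j (-k) ∧
    OppositeCharge s ε (Yminus γ s (.pos i) k) (Yminus γ s (.neg j) (-k)) i j (-k) ∧
    SameCharge s ε (Yplus γ s (.pos i) k) (Yminus γ s (.neg j) (-k)) i j (-(2 * k)) ∧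
    SameCharge s ε (Yminus γ s (.pos i) k) (Yplus γ s (.neg j) (-k)) i j 0 ∧
    ((∀ α β, ε α β = 1 ∨ ε α β = -1) →
      (∀ α α' β, ε (α + α') β = ε α β * ε α' β) →
      (∀ α β β', ε α (β + β') = ε α β * ε α β') →
      ∀ g g' : PM r, ε g.vec g'.vec = ε (PM.pos g.idx).vec (PM.pos g'.idx).vec) := by
  refine ⟨?_, ?_, ?_, ?_, ?_, ?_, ?_, ?_, bimultiplicative_eps_vec⟩
  · exact (isVertex_Yplus_pos s i k).sameCharge hε hr (isVertex_Yplus_pos s j k) rfl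
      (by decide) (mul_one _)
  · exact (isVertex_Yminus_pos s i k).sameCharge hε hr (isVertex_Yminus_pos s j k) rfl
      (by decide) (one_mul _)
  -- The weights q^{-k} of the annihilation part and q^k of the creation part cancel, whence m = 0.
  · refine (isVertex_Yplus_pos s i k).oppositeCharge hε hr (isVertex_Yminus_pos s j k) rfl
      (by decide) ?_
    rw [neg_mul_neg, ← qPow_add, neg_add_cancel]
  · refine (isVertex_Yminus_pos s i k).oppositeCharge hε hr (isVertex_Yplus_pos s j k) rfl
      (by decide) ?_
    rw [mul_one, qPow_zero]
  · refine (isVertex_Yplus_pos s i k).oppositeCharge hε hr (isVertex_Yplus_neg s j (-k)) rfl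
      (by decide) ?_
    rw [neg_mul_neg, mul_one]
  · exact (isVertex_Yminus_pos s i k).oppositeCharge hε hr (isVertex_Yminus_neg s j (-k)) rfl
      (by decide) (one_mul _)
  -- Both parts now carry q^{-k}, so the weights add up to q^{-2k}.
  · refine (isVertex_Yplus_pos s i k).sameCharge hε hr (isVertex_Yminus_neg s j (-k)) rfl
      (by decide) ?_
    rw [neg_mul, ← qPow_add, two_mul, neg_add]
  · refine (isVertex_Yminus_pos s i k).sameCharge hε hr (isVertex_Yplus_neg s j (-k)) rfl
      (by decide) ?_
    rw [one_mul, qPow_zero]
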